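/- Let $d=2^\ell$ with $\ell\in\{0,1,2,\dots\}$, and let $H$ be the $d\times d$ Hadamard matrix given by $H_1=[1]$, $H_{2n}=\begin{bmatrix}H_n&H_n\\H_n&-H_n\end{bmatrix}$. For $m\ge 1$ let $D^1,\dots,D^m$ be random diagonal $d\times d$ matrices and $b=(b_{j,k})_{j\le m,\,k\le d}$ a random vector such that all the diagonal entries of the $D^j$ and all the $b_{j,k}$ are independent, the former with law $\mathcal N(0,1)$ and the latter uniform on $[0,2\pi]$. Define, for $x\in\mathbb R^d$, $$\tilde h(x)=(HD^1x,\dots,HD^mx)\in\mathbb R^{md},\qquad h(x)=\sqrt{\tfrac{2}{md}}\,\cos\big(\tilde h(x)+b\big)\in\mathbb R^{md},$$ where the cosine is applied entrywise. There are absolute constants $C>0$ and $p\in\mathbb N$ such that for all $\ell$, all $\delta,\varepsilon\in(0,1/2)$ and every bounded set $\mathcal W\subset\mathbb R^d$, with $\Delta=\max(1,\mathrm{Diam}(\mathcal W))$, the following holds. If $$m\;\ge\; C\,\varepsilon^{-2}\,\Delta^2\,\log(1/\delta)\,\log^p\!\big(d\Delta/\varepsilon\big),$$ then with probability at least $1-\delta$,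 $$\Big|\langle h(x),h(y)\rangle-\exp\!\big(-\tfrac12\|x-y\|^2\big)\Big|\le\varepsilon\qquad\text{for all }x,y\in\mathcal W.$$ -/

import Mathlib

open MeasureTheory ProbabilityTheory

namespace RHTFeatures

noncomputable section

/-- The identification of the index set of a `2 × 2` block matrix, with blocks of size `2 ^ l`,
with `Fin (2 ^ (l + 1))`: the first block comes first. -/
def blockEquiv (l : ℕ) : Fin (2 ^ l) ⊕ Fin (2 ^ l) ≃ Fin (2 ^ (l + 1)) :=
  finSumFinEquiv.trans (finCongr (by rw [pow_succ, mul_two]))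

/-- The (unnormalized, Sylvester) Hadamard matrix `H_d`, `d = 2 ^ l`:
`H_1 = [1]` and `H_{2d} = [[H_d, H_d], [H_d, -H_d]]`. -/
def hadamard : (l : ℕ) → Matrix (Fin (2 ^ l)) (Fin (2 ^ l)) ℝ
  | 0 => Matrix.of fun _ _ => 1
  | l + 1 =>
      Matrix.reindex (blockEquiv l) (blockEquiv l)
        (Matrix.fromBlocks (hadamard l) (hadamard l) (hadamard l) (-hadamard l))

/-- The stacked randomized Hadamard transform `z ↦ (H D^1 z, …, H D^m z)`, for the diagonal matrices
`D^j = Diag (g j)`. Its entry at `(j, k)` is `(H D^j z)_k`. -/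
def rht {m l : ℕ} (g : Fin m → Fin (2 ^ l) → ℝ) (z : EuclideanSpace ℝ (Fin (2 ^ l))) :
    Fin m × Fin (2 ^ l) → ℝ :=
  fun q => ((hadamard l * Matrix.diagonal (g q.1)).mulVec (WithLp.ofLp z)) q.2

/-- The random Fourier features `h(x) = √(2 / (m d)) cos (rht x + b)`, `d = 2 ^ l`, the cosine
acting entrywise, for the diagonals `g` and the phases `b`. -/
def features {m l : ℕ} (g b : Fin m → Fin (2 ^ l) → ℝ) (x : EuclideanSpace ℝ (Fin (2 ^ l))) :
    EuclideanSpace ℝ (Fin m × Fin (2 ^ l)) :=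
  WithLp.toLp 2 fun q =>
    Real.sqrt (2 / ((m : ℝ) * (2 : ℝ) ^ l)) * Real.cos (rht g x q + b q.1 q.2)

/-- The RBF kernel `exp (-‖x - y‖² / 2)`. -/
def rbfKernel {l : ℕ} (x y : EuclideanSpace ℝ (Fin (2 ^ l))) : ℝ :=
  Real.exp (-(‖x - y‖ ^ 2 / 2))

/-- `(G, B)` is a random seed on the probability space `(Ω, μ)`: all the random variables `G j k`
and `B j k` are independent, the `G j k` are standard Gaussian and the `B j k` are uniform on
`[0, 2π]`. -/
structure IsSeed {Ω : Type*} [MeasurableSpace Ω] (μ : Measure Ω) {m l : ℕ}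
    (G B : Fin m → Fin (2 ^ l) → Ω → ℝ) : Prop where
  measurable_diag : ∀ j k, Measurable (G j k)
  measurable_phase : ∀ j k, Measurable (B j k)
  gaussian_diag : ∀ j k, μ.map (G j k) = gaussianReal 0 1
  uniform_phase : ∀ j k, pdf.IsUniform (B j k) (Set.Icc 0 (2 * Real.pi)) μ volume
  indep : iIndepFun
    (Sum.elim (fun q : Fin m × Fin (2 ^ l) => G q.1 q.2) (fun q : Fin m × Fin (2 ^ l) => B q.1 q.2)) μ

end

end RHTFeatures

/-! By the product-to-sum formula, `⟨h(x), h(y)⟩` is an average of `cos(HD(x-y))` plus an average of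
`cos(HD(x+y) + 2b)` (`inner_features`). Both are instances of `cosAverage`, whose Gaussian mean at
`z` is `exp(-‖z‖²/2)` times its value at `z = 0`. That value is 1 without phases; with phases `2b`
it is a mean of independent centred variables, hence small. It remains to control the deviation from
the mean uniformly over a ball of radius `R`.

Since `H` is orthogonal up to scaling, the squared gradient of `cosAverage` in the Gaussian
variables is at most `‖z‖_∞²/m` (`sum_cosAverageGrad_sq_le`). A deviation `t` therefore has
probability at most `2 exp(-c t² m/‖z‖_∞²)`. A direct union bound over a net of the ball is too
expensive, so coordinates are restored by dyadic size. A vector whose nonzero coordinates exceed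
`R/2^(s+1)` has at most `4^(s+1)` of them, so the net at scale `s` has log-cardinality of order
`4^s`, up to logarithms. Integrating out only the Gaussians attached to its coordinates of size at
most `R/2^s` gives an exponent of order `4^s t² m/R²` (`measure_cosAverage_largePart_le`). The
factors `4^s` cancel, so `m` of order `(R/t)²` suffices up to logarithms. The scales telescope
(`abs_sub_exp_mul_le_of_largePart`), and a crude Lipschitz bound passes from the grid to all
vectors.

`W` may lie far from the origin, so `x+y` need not be small. With `c ∈ W`, the part `2HDc` of the
transform is absorbed into the phases, whose uniform law is translation invariant modulo `2π`. -/

namespace RHTFeatures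

/-! ### Gaussian concentration by rotation -/

section GaussianConcentration

variable {ι : Type*} [Fintype ι]

/-- The standard Gaussian measure on `ι → ℝ`. -/
noncomputable abbrev gaussianPi (ι : Type*) [Fintype ι] : Measure (ι → ℝ) :=
  Measure.pi fun _ => gaussianReal 0 1

theorem integrable_exp_linear_gaussianPi (c : ι → ℝ) :
    Integrable (fun x => Real.exp (∑ i, c i * x i)) (gaussianPi ι) := by
  simp_rw [Real.exp_sum]
  exact Integrable.fintype_prod (f := fun i x => Real.exp (c i * x))
    fun i => integrable_exp_mul_gaussianReal (c i)

theorem integral_exp_linear_gaussianPi (c : ι → ℝ) :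
    ∫ x, Real.exp (∑ i, c i * x i) ∂gaussianPi ι = Real.exp ((∑ i, c i ^ 2) / 2) := by
  simp_rw [Real.exp_sum]
  rw [integral_fintype_prod_eq_prod (f := fun i x => Real.exp (c i * x)), Finset.sum_div,
    Real.exp_sum]
  refine Finset.prod_congr rfl fun i _ => ?_
  have := mgf_gaussianReal (p := gaussianReal 0 1) (X := id) (μ := 0) (v := 1) (by simp) (c i)
  simpa [mgf] using this

theorem lintegral_exp_linear_gaussianPi (c : ι → ℝ) :
    ∫⁻ x, ENNReal.ofReal (Real.exp (∑ i, c i * x i)) ∂gaussianPi ι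
      = ENNReal.ofReal (Real.exp ((∑ i, c i ^ 2) / 2)) := by
  rw [← ofReal_integral_eq_lintegral_ofReal (integrable_exp_linear_gaussianPi c)
    (ae_of_all _ fun _ => (Real.exp_pos _).le), integral_exp_linear_gaussianPi]

instance isGaussian_gaussianPi : IsGaussian (gaussianPi ι) := by
  have h : iIndepFun (fun (i : ι) (x : ι → ℝ) => x i) (gaussianPi ι) :=
    iIndepFun_pi (X := fun _ => id) fun _ => aemeasurable_id
  have := (h.hasGaussianLaw fun i => ⟨by
    change IsGaussian (Measure.map (Function.eval i) (gaussianPi ι))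
    rw [(measurePreserving_eval (fun _ : ι => gaussianReal 0 1) i).map_eq]
    infer_instance⟩).isGaussian_map
  simpa using this

theorem measurePreserving_rotation_gaussianPi (θ : ℝ) :
    MeasurePreserving (ContinuousLinearMap.rotation (E := ι → ℝ) θ)
      ((gaussianPi ι).prod (gaussianPi ι)) ((gaussianPi ι).prod (gaussianPi ι)) := by
  refine ⟨(ContinuousLinearMap.rotation θ).continuous.measurable, ?_⟩
  refine IsGaussian.map_rotation_eq_self ?_ θ
  ext i
  have : Integrable (id : (ι → ℝ) → ι → ℝ) (gaussianPi ι) := IsGaussian.integrable_id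
  rw [eval_integral (fun i => this.eval i)]
  simp [integral_eval]

/-- Jensen's inequality for the exponential along an interval. -/
theorem ofReal_exp_intervalIntegral_le {a : ℝ} (ha : 0 < a) {f : ℝ → ℝ} (hf : Continuous f) :
    ENNReal.ofReal (Real.exp (∫ θ in (0 : ℝ)..a, f θ)) ≤
      ENNReal.ofReal a⁻¹ * ∫⁻ θ in Set.Ioc 0 a, ENNReal.ofReal (Real.exp (a * f θ)) := by
  have hvol : volume.real (Set.Ioc 0 a) = a := by simp [Measure.real, ha.le]
  have hint : ∀ g : ℝ → ℝ, Continuous g → IntegrableOn g (Set.Ioc 0 a) := fun g hg =>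
    (hg.integrableOn_Icc (a := 0) (b := a)).mono_set Set.Ioc_subset_Icc_self
  have h := convexOn_exp.map_set_average_le (μ := volume) (t := Set.Ioc 0 a)
    (f := fun θ => a * f θ) Real.continuous_exp.continuousOn isClosed_univ
    (by simp [ha]) (by simp) (by simp)
    (hint _ (by fun_prop)) (hint _ (by fun_prop))
  rw [setAverage_eq, setAverage_eq, hvol, integral_const_mul] at h
  rw [intervalIntegral.integral_of_le ha.le]
  simp only [smul_eq_mul, inv_mul_cancel_left₀ ha.ne'] at h
  rw [← ofReal_integral_eq_lintegral_ofReal (hint _ (by fun_prop))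
    (ae_of_all _ fun _ => (Real.exp_pos _).le), ← ENNReal.ofReal_mul (by positivity)]
  exact ENNReal.ofReal_le_ofReal h

variable {F : (ι → ℝ) → ℝ} {D : (ι → ℝ) → ι → ℝ}

/-- The arc `cos θ • p.1 + sin θ • p.2` joins `p.1` to `p.2`, and its velocity is the second
component of the rotated pair. -/
theorem sub_eq_intervalIntegral_rotation (hD : Continuous D)
    (hF : ∀ x, HasFDerivAt F (∑ i, D x i • ContinuousLinearMap.proj (R := ℝ) (φ := fun _ => ℝ) i) x)
    (p : (ι → ℝ) × (ι → ℝ)) :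
    F p.2 - F p.1 = ∫ θ in (0 : ℝ)..(Real.pi / 2),
      ∑ i, D (ContinuousLinearMap.rotation θ p).1 i * (ContinuousLinearMap.rotation θ p).2 i := by
  have hder : ∀ θ : ℝ, HasDerivAt (fun θ => F (Real.cos θ • p.1 + Real.sin θ • p.2))
      (∑ i, D (ContinuousLinearMap.rotation θ p).1 i *
        (ContinuousLinearMap.rotation θ p).2 i) θ := by
    intro θ
    have h1 : HasDerivAt (fun θ => Real.cos θ • p.1 + Real.sin θ • p.2)
        (-Real.sin θ • p.1 + Real.cos θ • p.2) θ :=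
      ((Real.hasDerivAt_cos θ).smul_const p.1).add ((Real.hasDerivAt_sin θ).smul_const p.2)
    refine ((hF (Real.cos θ • p.1 + Real.sin θ • p.2)).comp_hasDerivAt θ h1).congr_deriv ?_
    simp [ContinuousLinearMap.rotation_apply]
  rw [intervalIntegral.integral_eq_sub_of_hasDerivAt (fun θ _ => hder θ)]
  · simp
  · refine Continuous.intervalIntegrable ?_ _ _
    simp only [ContinuousLinearMap.rotation_apply]
    fun_prop

/-- The Maurey–Pisier argument. Jensen moves the exponential inside the integral along the arc. For
each angle the rotated pair is again a pair of independent Gaussians, so, given the first component,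
the integrand is the exponential of a linear Gaussian form with variance controlled by `V`. -/
theorem lintegral_exp_sub_gaussianPi_le (hD : Continuous D)
    (hF : ∀ x, HasFDerivAt F (∑ i, D x i • ContinuousLinearMap.proj (R := ℝ) (φ := fun _ => ℝ) i) x)
    {V : ℝ} (hV : ∀ x, ∑ i, D x i ^ 2 ≤ V) (t : ℝ) :
    ∫⁻ p, ENNReal.ofReal (Real.exp (t * (F p.2 - F p.1))) ∂(gaussianPi ι).prod (gaussianPi ι)
      ≤ ENNReal.ofReal (Real.exp (Real.pi ^ 2 * V / 4 * t ^ 2 / 2)) := by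
  set γ := gaussianPi ι
  set a : ℝ := Real.pi / 2 with ha_def
  have ha : 0 < a := by positivity
  let Φ : (ι → ℝ) × (ι → ℝ) → ENNReal := fun q =>
    ENNReal.ofReal (Real.exp (∑ i, (a * t * D q.1 i) * q.2 i))
  have hΦ : Measurable Φ := by
    refine Measurable.ennreal_ofReal (Continuous.measurable ?_)
    fun_prop
  have hpt : ∀ p : (ι → ℝ) × (ι → ℝ), ENNReal.ofReal (Real.exp (t * (F p.2 - F p.1))) ≤
      ENNReal.ofReal a⁻¹ * ∫⁻ θ in Set.Ioc 0 a, Φ (ContinuousLinearMap.rotation θ p) := by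
    intro p
    rw [sub_eq_intervalIntegral_rotation hD hF p, ← intervalIntegral.integral_const_mul]
    refine (ofReal_exp_intervalIntegral_le ha ?_).trans_eq ?_
    · simp only [ContinuousLinearMap.rotation_apply]
      fun_prop
    · simp only [Φ, Finset.mul_sum, mul_assoc]
  have hE : ∀ θ : ℝ, ∫⁻ p, Φ (ContinuousLinearMap.rotation θ p) ∂γ.prod γ ≤
      ENNReal.ofReal (Real.exp (Real.pi ^ 2 * V / 4 * t ^ 2 / 2)) := by
    intro θ
    rw [(measurePreserving_rotation_gaussianPi θ).lintegral_comp hΦ,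
      lintegral_prod _ hΦ.aemeasurable]
    refine (lintegral_mono (g := fun _ =>
      ENNReal.ofReal (Real.exp (Real.pi ^ 2 * V / 4 * t ^ 2 / 2))) fun x => ?_).trans_eq (by simp)
    simp only [Φ, lintegral_exp_linear_gaussianPi]
    refine ENNReal.ofReal_le_ofReal (Real.exp_le_exp.2 ?_)
    simp only [mul_pow, ← Finset.mul_sum]
    have := mul_le_mul_of_nonneg_left (hV x) (by positivity : 0 ≤ a ^ 2 * t ^ 2)
    rw [ha_def] at this ⊢
    nlinarith
  calc _ ≤ ∫⁻ p, ENNReal.ofReal a⁻¹ * ∫⁻ θ in Set.Ioc 0 a,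
        Φ (ContinuousLinearMap.rotation θ p) ∂volume ∂γ.prod γ := lintegral_mono hpt
    _ = ENNReal.ofReal a⁻¹ * ∫⁻ θ in Set.Ioc 0 a,
        ∫⁻ p, Φ (ContinuousLinearMap.rotation θ p) ∂γ.prod γ := by
      have hm : Measurable (Function.uncurry fun (p : (ι → ℝ) × (ι → ℝ)) (θ : ℝ) =>
          Φ (ContinuousLinearMap.rotation θ p)) := by
        refine hΦ.comp (Continuous.measurable ?_)
        simp only [ContinuousLinearMap.rotation_apply]
        fun_prop
      rw [lintegral_const_mul' _ _ ENNReal.ofReal_ne_top, lintegral_lintegral_swap hm.aemeasurable]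
    _ ≤ ENNReal.ofReal a⁻¹ * ∫⁻ _ in Set.Ioc 0 a,
        ENNReal.ofReal (Real.exp (Real.pi ^ 2 * V / 4 * t ^ 2 / 2)) := by
      gcongr with θ
      exact hE θ
    _ = _ := by
      rw [setLIntegral_const, Real.volume_Ioc, sub_zero, mul_comm (ENNReal.ofReal (Real.exp _)),
        ← mul_assoc, ← ENNReal.ofReal_mul (by positivity), inv_mul_cancel₀ ha.ne']
      simp

/-- Concentration of bounded smooth Lipschitz functions of a standard Gaussian vector. -/
theorem hasSubgaussianMGF_gaussianPi (hD : Continuous D)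
    (hF : ∀ x, HasFDerivAt F (∑ i, D x i • ContinuousLinearMap.proj (R := ℝ) (φ := fun _ => ℝ) i) x)
    {V : NNReal} (hV : ∀ x, ∑ i, D x i ^ 2 ≤ V) {M : ℝ} (hM : ∀ x, |F x| ≤ M) :
    HasSubgaussianMGF (fun x => F x - ∫ y, F y ∂gaussianPi ι)
      (Real.toNNReal (Real.pi ^ 2 / 4) * V) (gaussianPi ι) := by
  set γ := gaussianPi ι
  have hFc : Continuous F := continuous_iff_continuousAt.2 fun x => (hF x).continuousAt
  have hFi : Integrable F γ := Integrable.of_bound hFc.aestronglyMeasurable M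
    (ae_of_all _ fun x => by simpa using hM x)
  have hei : ∀ s : ℝ, Integrable (fun x => Real.exp (s * F x)) γ := fun s =>
    Integrable.of_bound (by fun_prop : Continuous _).aestronglyMeasurable (Real.exp (|s| * M))
    (ae_of_all _ fun x => by
      rw [Real.norm_eq_abs, Real.abs_exp, Real.exp_le_exp]
      refine (le_abs_self _).trans ?_
      rw [abs_mul]
      exact mul_le_mul_of_nonneg_left (hM x) (abs_nonneg s))
  have hsplit : ∀ t x, Real.exp (t * (F x - ∫ y, F y ∂γ)) =
      Real.exp (t * F x) * Real.exp (-t * ∫ y, F y ∂γ) := fun t x => by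
    rw [← Real.exp_add]; ring_nf
  refine ⟨fun t => ?_, fun t => ?_⟩
  · simp_rw [hsplit]
    exact (hei t).mul_const _
  -- Jensen replaces the mean by an independent copy, reducing to the symmetrized estimate.
  · have hjensen : Real.exp (-t * ∫ y, F y ∂γ) ≤ ∫ y, Real.exp (-t * F y) ∂γ := by
      have := convexOn_exp.map_integral_le (μ := γ) (f := fun y => -t * F y)
        Real.continuous_exp.continuousOn isClosed_univ (by simp) (hFi.const_mul _) (hei _)
      rwa [integral_const_mul] at this
    have hprod : ∫ p, Real.exp (t * (F p.2 - F p.1)) ∂γ.prod γ =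
        (∫ x, Real.exp (-t * F x) ∂γ) * ∫ y, Real.exp (t * F y) ∂γ := by
      rw [← integral_prod_mul]
      congr 1 with p
      rw [← Real.exp_add]; ring_nf
    have hle : ∫ p, Real.exp (t * (F p.2 - F p.1)) ∂γ.prod γ ≤
        Real.exp (Real.pi ^ 2 * V / 4 * t ^ 2 / 2) := by
      rw [integral_eq_lintegral_of_nonneg_ae (ae_of_all _ fun _ => (Real.exp_pos _).le)
        (by fun_prop : Continuous _).aestronglyMeasurable]
      exact ENNReal.toReal_le_of_le_ofReal (Real.exp_pos _).le
        (lintegral_exp_sub_gaussianPi_le hD hF hV t)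
    calc mgf (fun x => F x - ∫ y, F y ∂γ) γ t
        = (∫ y, Real.exp (t * F y) ∂γ) * Real.exp (-t * ∫ y, F y ∂γ) := by
          simp only [mgf, hsplit, integral_mul_const]
      _ ≤ (∫ y, Real.exp (t * F y) ∂γ) * ∫ y, Real.exp (-t * F y) ∂γ := by
          gcongr
      _ ≤ Real.exp (Real.pi ^ 2 * V / 4 * t ^ 2 / 2) := by rw [mul_comm, ← hprod]; exact hle
      _ = _ := by
          congr 1
          rw [NNReal.coe_mul, Real.coe_toNNReal _ (by positivity)]
          ring

end GaussianConcentration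

/-! ### Mean and fluctuations of the cosine average -/

section CosineAverage

set_option linter.unusedSectionVars false

variable {J κ : Type*} [Fintype J] [Fintype κ]

/-- The entry `(H D^j z)_k`, `q = (j, k)`, of the transform with diagonals `g (j, ·)`. -/
def transformEntry (H : Matrix κ κ ℝ) (g : J × κ → ℝ) (z : κ → ℝ) (q : J × κ) : ℝ :=
  ∑ i, H q.2 i * g (q.1, i) * z i

/-- The average of the cosines of the entries of the randomized transform of `z`, with phases `φ`. -/
noncomputable def cosAverage (H : Matrix κ κ ℝ) (g φ : J × κ → ℝ) (z : κ → ℝ) : ℝ :=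
  (Fintype.card (J × κ) : ℝ)⁻¹ * ∑ q, Real.cos (transformEntry H g z q + φ q)

/-- The coefficient of `g p` in `transformEntry H g z q`. -/
def transformCoeff [DecidableEq J] (H : Matrix κ κ ℝ) (z : κ → ℝ) (q p : J × κ) : ℝ :=
  if p.1 = q.1 then H q.2 p.2 * z p.2 else 0

variable {H : Matrix κ κ ℝ} {g φ : J × κ → ℝ} {z : κ → ℝ}

theorem transformEntry_eq_sum [DecidableEq J] (q : J × κ) :
    transformEntry H g z q = ∑ p, transformCoeff H z q p * g p := by
  simp only [transformEntry, transformCoeff, Fintype.sum_prod_type, ite_mul, zero_mul]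
  rw [Finset.sum_eq_single q.1 (fun b _ hb => by simp [hb]) (by simp)]
  simp [mul_right_comm]

theorem sum_transformCoeff_sq [DecidableEq J] (hH : ∀ k i, H k i ^ 2 = 1) (q : J × κ) :
    ∑ p, transformCoeff H z q p ^ 2 = ∑ i, z i ^ 2 := by
  simp only [transformCoeff, Fintype.sum_prod_type, ite_pow]
  rw [Finset.sum_eq_single q.1 (fun b _ hb => by simp [hb]) (by simp)]
  simp [mul_pow, hH]

@[simp]
theorem transformEntry_zero (q : J × κ) : transformEntry H g 0 q = 0 := by
  simp [transformEntry]

theorem transformEntry_add (z w : κ → ℝ) (q : J × κ) :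
    transformEntry H g (z + w) q = transformEntry H g z q + transformEntry H g w q := by
  simp [transformEntry, mul_add, Finset.sum_add_distrib]

theorem transformEntry_sub (z w : κ → ℝ) (q : J × κ) :
    transformEntry H g (z - w) q = transformEntry H g z q - transformEntry H g w q := by
  simp [transformEntry, mul_sub, Finset.sum_sub_distrib]

theorem cosAverage_zero_right (g' : J × κ → ℝ) : cosAverage H g φ 0 = cosAverage H g' φ 0 := by
  simp [cosAverage]

/-- Treating one summand as a phase serves both for conditioning on the large coordinates and for
recentring. -/
theorem cosAverage_add (z w : κ → ℝ) :
    cosAverage H g φ (z + w) = cosAverage H g (fun q => transformEntry H g w q + φ q) z := by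
  simp [cosAverage, transformEntry_add, add_assoc]

theorem abs_cosAverage_le_one : |cosAverage H g φ z| ≤ 1 := by
  rw [cosAverage, abs_mul, abs_of_nonneg (by positivity)]
  rcases (Nat.cast_nonneg (α := ℝ) (Fintype.card (J × κ))).eq_or_lt with h | h
  · rw [← h]
    simp
  · rw [inv_mul_le_one₀ h]
    refine (Finset.abs_sum_le_sum_abs _ _).trans ?_
    refine (Finset.sum_le_sum fun q _ => Real.abs_cos_le_one _).trans ?_
    simp

theorem integral_cos_linear_gaussianPi {ι : Type*} [Fintype ι] (c : ι → ℝ) (a : ℝ) :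
    ∫ x, Real.cos (∑ i, c i * x i + a) ∂gaussianPi ι
      = Real.exp (-(∑ i, c i ^ 2) / 2) * Real.cos a := by
  have key : ∫ x, Complex.exp (∑ i, (c i : ℂ) * x i * Complex.I) ∂gaussianPi ι
      = Complex.exp (-(∑ i, (c i : ℂ) ^ 2) / 2) := by
    simp_rw [Complex.exp_sum]
    rw [integral_fintype_prod_eq_prod (f := fun i (x : ℝ) => Complex.exp ((c i : ℂ) * x * Complex.I)),
      ← Finset.sum_neg_distrib, Finset.sum_div, Complex.exp_sum]
    refine Finset.prod_congr rfl fun i _ => ?_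
    rw [← charFun_apply_real, charFun_gaussianReal]
    simp [neg_div]
  have hint : Integrable (fun x : ι → ℝ =>
      Complex.exp (∑ i, (c i : ℂ) * x i * Complex.I) * Complex.exp (a * Complex.I))
      (gaussianPi ι) := by
    refine Integrable.of_bound (by fun_prop : Continuous _).aestronglyMeasurable 1
      (ae_of_all _ fun x => ?_)
    rw [← Complex.exp_add, ← Finset.sum_mul, ← add_mul]
    have := Complex.norm_exp_ofReal_mul_I (∑ i, c i * x i + a)
    push_cast at this
    exact this.le
  have h2 : ∀ x : ι → ℝ, Real.cos (∑ i, c i * x i + a) =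
      RCLike.re (Complex.exp (∑ i, (c i : ℂ) * x i * Complex.I) * Complex.exp (a * Complex.I)) := by
    intro x
    rw [← Complex.exp_add, ← Finset.sum_mul, ← add_mul]
    have := Complex.exp_ofReal_mul_I_re (∑ i, c i * x i + a)
    push_cast at this
    exact this.symm
  simp_rw [h2]
  rw [integral_re hint, integral_mul_const, key]
  have h3 : Complex.exp (-(∑ i, (c i : ℂ) ^ 2) / 2) =
    ((Real.exp (-(∑ i, c i ^ 2) / 2) : ℝ) : ℂ) := by push_cast; rfl
  rw [h3]
  exact (Complex.re_ofReal_mul _ _).trans (by rw [Complex.exp_ofReal_mul_I_re])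

@[fun_prop]
theorem continuous_transformEntry {X : Type*} [TopologicalSpace X] {a : X → J × κ → ℝ}
    (ha : Continuous a) (z : κ → ℝ) (q : J × κ) :
    Continuous fun x => transformEntry H (a x) z q := by
  unfold transformEntry
  fun_prop

@[fun_prop]
theorem continuous_cosAverage {X : Type*} [TopologicalSpace X] {a b : X → J × κ → ℝ}
    (ha : Continuous a) (hb : Continuous b) (z : κ → ℝ) :
    Continuous fun x => cosAverage H (a x) (b x) z := by
  unfold cosAverage
  fun_prop

theorem integral_cosAverage (hH : ∀ k i, H k i ^ 2 = 1) (φ : J × κ → ℝ) (z : κ → ℝ) :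
    ∫ g, cosAverage H g φ z ∂gaussianPi (J × κ)
      = Real.exp (-(∑ i, z i ^ 2) / 2) * cosAverage H 0 φ 0 := by
  classical
  simp only [cosAverage, transformEntry_eq_sum]
  rw [integral_const_mul, integral_finsetSum]
  · simp_rw [integral_cos_linear_gaussianPi, sum_transformCoeff_sq hH]
    simp [Finset.mul_sum, mul_left_comm]
  · intro q _
    exact Integrable.of_bound (by fun_prop : Continuous _).aestronglyMeasurable 1
      (ae_of_all _ fun x => by simpa using Real.abs_cos_le_one _)

/-- The gradient of `cosAverage` in the Gaussian variables. -/
noncomputable def cosAverageGrad [DecidableEq J] (H : Matrix κ κ ℝ) (φ : J × κ → ℝ) (z : κ → ℝ)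
    (g : J × κ → ℝ) (p : J × κ) : ℝ :=
  (Fintype.card (J × κ) : ℝ)⁻¹ *
    ∑ q, -Real.sin (transformEntry H g z q + φ q) * transformCoeff H z q p

theorem hasFDerivAt_cosAverage [DecidableEq J] (H : Matrix κ κ ℝ) (φ : J × κ → ℝ) (z : κ → ℝ)
    (g : J × κ → ℝ) :
    HasFDerivAt (fun g => cosAverage H g φ z) (∑ p, cosAverageGrad H φ z g p •
      ContinuousLinearMap.proj (R := ℝ) (φ := fun _ => ℝ) p) g := by
  have h1 : ∀ q, HasFDerivAt (fun g => transformEntry H g z q + φ q)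
      (∑ p, transformCoeff H z q p • ContinuousLinearMap.proj (R := ℝ) (φ := fun _ => ℝ) p) g := by
    intro q
    simp only [transformEntry_eq_sum]
    refine (HasFDerivAt.fun_sum fun p _ => ?_).add_const _
    exact (ContinuousLinearMap.hasFDerivAt
      (ContinuousLinearMap.proj (R := ℝ) (φ := fun _ : J × κ => ℝ) p)).const_mul _
  refine ((HasFDerivAt.fun_sum fun q _ => (h1 q).cos).const_mul
    (Fintype.card (J × κ) : ℝ)⁻¹).congr_fderiv ?_
  ext x
  simp only [cosAverageGrad, smul_apply, sum_apply,
    ContinuousLinearMap.proj_apply, smul_eq_mul, Finset.mul_sum, Finset.sum_mul]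
  rw [Finset.sum_comm]
  simp only [mul_assoc]

theorem continuous_cosAverageGrad [DecidableEq J] :
    Continuous (cosAverageGrad H φ z : (J × κ → ℝ) → J × κ → ℝ) := by
  unfold cosAverageGrad transformEntry
  fun_prop

variable [DecidableEq κ]

theorem isHadamard_apply_sq (hH : H.IsHadamard) (k i : κ) : H k i ^ 2 = 1 := by
  simpa [sq] using (Unitary.mem_iff.1 (hH.apply_mem k i)).1

theorem isHadamard_sum_sq (hH : H.IsHadamard) (s : κ → ℝ) :
    ∑ i, (∑ k, H k i * s k) ^ 2 = Fintype.card κ * ∑ k, s k ^ 2 := by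
  have h := congrArg (fun A : Matrix κ κ ℝ => s ⬝ᵥ A.mulVec s) hH.mul_conjTranspose
  simp only [Matrix.smul_mulVec, Matrix.one_mulVec, dotProduct_smul, smul_eq_mul] at h
  rw [← Matrix.mulVec_mulVec, Matrix.dotProduct_mulVec] at h
  simp only [dotProduct, Matrix.vecMul, Matrix.mulVec, Matrix.conjTranspose_apply,
    star_trivial] at h
  simpa [sq, mul_comm] using h

/-- In block `j` the gradient is `-z_i (Hᵀ s_j)_i / N`, where `s_j` is a vector of sines and `‖Hᵀ
s_j‖² = d‖s_j‖² ≤ d²` for `d = card κ`. Thus only the sup norm of `z` enters, and this is what makes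
the multiscale argument work. -/
theorem sum_cosAverageGrad_sq_le [DecidableEq J] (hH : H.IsHadamard) (φ : J × κ → ℝ) {z : κ → ℝ}
    {B : ℝ} (hz : ∀ i, |z i| ≤ B) (g : J × κ → ℝ) :
    ∑ p, cosAverageGrad H φ z g p ^ 2 ≤ B ^ 2 / Fintype.card J := by
  obtain ⟨N, hN⟩ : ∃ N : ℝ, N = (Fintype.card (J × κ) : ℝ) := ⟨_, rfl⟩
  let s : J → κ → ℝ := fun j k => Real.sin (transformEntry H g z (j, k) + φ (j, k))
  have h1 : ∀ j i, cosAverageGrad H φ z g (j, i) = N⁻¹ * (-z i * ∑ k, H k i * s j k) := by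
    intro j i
    simp only [cosAverageGrad, transformCoeff, Fintype.sum_prod_type, mul_ite, mul_zero]
    rw [Finset.sum_eq_single j (fun b _ hb => by simp [hb.symm]) (by simp)]
    simp only [if_true, Finset.mul_sum, s, hN]
    exact Finset.sum_congr rfl fun k _ => by ring
  have h2 : ∀ j, ∑ i, cosAverageGrad H φ z g (j, i) ^ 2 ≤
      N⁻¹ ^ 2 * (B ^ 2 * (Fintype.card κ * Fintype.card κ)) := by
    intro j
    calc ∑ i, cosAverageGrad H φ z g (j, i) ^ 2
        ≤ ∑ i, N⁻¹ ^ 2 * (B ^ 2 * (∑ k, H k i * s j k) ^ 2) := by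
          refine Finset.sum_le_sum fun i _ => ?_
          rw [h1, mul_pow, mul_pow, neg_sq]
          have : z i ^ 2 ≤ B ^ 2 := sq_le_sq' (abs_le.1 (hz i)).1 (abs_le.1 (hz i)).2
          gcongr
      _ = N⁻¹ ^ 2 * (B ^ 2 * (Fintype.card κ * ∑ k, s j k ^ 2)) := by
          rw [← isHadamard_sum_sq hH, ← Finset.mul_sum, ← Finset.mul_sum]
      _ ≤ _ := by
          gcongr
          refine (Finset.sum_le_sum fun k _ => Real.sin_sq_le_one _).trans ?_
          simp
  rw [Fintype.sum_prod_type]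
  refine (Finset.sum_le_sum fun j _ => h2 j).trans ?_
  rw [Finset.sum_const, Finset.card_univ, nsmul_eq_mul, hN, Fintype.card_prod, Nat.cast_mul]
  rcases (Nat.cast_nonneg (α := ℝ) (Fintype.card J)).eq_or_lt with h | h
  · rw [← h]; simp
  rcases (Nat.cast_nonneg (α := ℝ) (Fintype.card κ)).eq_or_lt with h' | h'
  · rw [← h']; simp; positivity
  · apply le_of_eq
    field_simp

/-- Concentration of `cosAverage` for a vector with entries at most `B`. -/
theorem measure_cosAverage_sub_le (hH : H.IsHadamard) (φ : J × κ → ℝ) {z : κ → ℝ} {B : ℝ}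
    (hz : ∀ i, |z i| ≤ B) {t : ℝ} (ht : 0 ≤ t) :
    (gaussianPi (J × κ)).real {g | t ≤ |cosAverage H g φ z -
        Real.exp (-(∑ i, z i ^ 2) / 2) * cosAverage H 0 φ 0|} ≤
      2 * Real.exp (-(2 * t ^ 2 * Fintype.card J / (Real.pi ^ 2 * B ^ 2))) := by
  classical
  have h := hasSubgaussianMGF_gaussianPi (F := fun g => cosAverage H g φ z)
    continuous_cosAverageGrad
    (hasFDerivAt_cosAverage H φ z) (V := Real.toNNReal (B ^ 2 / Fintype.card J))
    (fun g => (sum_cosAverageGrad_sq_le hH φ hz g).trans (Real.le_coe_toNNReal _)) (M := 1) (fun _ => abs_cosAverage_le_one)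
  rw [integral_cosAverage (isHadamard_apply_sq hH)] at h
  have e : -t ^ 2 / (2 * ((Real.toNNReal (Real.pi ^ 2 / 4) *
      Real.toNNReal (B ^ 2 / Fintype.card J) : NNReal) : ℝ)) =
      -(2 * t ^ 2 * Fintype.card J / (Real.pi ^ 2 * B ^ 2)) := by
    rw [NNReal.coe_mul, Real.coe_toNNReal _ (by positivity), Real.coe_toNNReal _ (by positivity)]
    -- If `B = 0` or `J` is empty, both exponents are 0 because division by zero is 0, and the bound
    -- is trivial.
    rcases eq_or_ne B 0 with rfl | hB
    · simp
    rcases (Nat.cast_nonneg (α := ℝ) (Fintype.card J)).eq_or_lt with hJ | hJ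
    · rw [← hJ]; simp
    · have := Real.pi_pos
      field_simp
      norm_num
  have hp := h.measure_ge_le ht
  have hn := h.neg.measure_ge_le ht
  rw [e] at hp hn
  refine le_trans (measureReal_mono (fun g hg => ?_))
    ((measureReal_union_le _ _).trans ((add_le_add hp hn).trans_eq (two_mul _).symm))
  rw [Set.mem_ofPred_eq] at hg
  exact le_abs.1 hg

/-- Choosing each coordinate from one of two independent copies preserves a product measure. -/
theorem measurePreserving_mix {ι : Type*} [Fintype ι] (ν : Measure ℝ) [IsProbabilityMeasure ν]
    (P : ι → Prop) [DecidablePred P] :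
    MeasurePreserving (fun (p : (ι → ℝ) × (ι → ℝ)) i => if P i then p.2 i else p.1 i)
      ((Measure.pi fun _ => ν).prod (Measure.pi fun _ => ν)) (Measure.pi fun _ => ν) := by
  have hm : Measurable (fun (p : (ι → ℝ) × (ι → ℝ)) i => if P i then p.2 i else p.1 i) := by
    refine measurable_pi_lambda _ fun i => ?_
    split_ifs <;> fun_prop
  refine ⟨hm, (Measure.pi_eq fun s hs => ?_).symm⟩
  have : (fun (p : (ι → ℝ) × (ι → ℝ)) i => if P i then p.2 i else p.1 i) ⁻¹' (Set.univ.pi s) =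
      (Set.univ.pi fun i => if P i then Set.univ else s i) ×ˢ
        (Set.univ.pi fun i => if P i then s i else Set.univ) := by
    ext p
    simp only [Set.mem_preimage, Set.mem_univ_pi, Set.mem_prod, ← forall_and]
    refine forall_congr' fun i => ?_
    split_ifs <;> simp
  rw [Measure.map_apply hm (.univ_pi hs), this, Measure.prod_prod, Measure.pi_pi, Measure.pi_pi,
    ← Finset.prod_mul_distrib]
  refine Finset.prod_congr rfl fun i _ => ?_
  split_ifs <;> simp

/-- The coordinates of `w` of modulus greater than `B`. -/
noncomputable def largePart (B : ℝ) (w : κ → ℝ) (i : κ) : ℝ := if B < |w i| then w i else 0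

/-- Concentration of `cosAverage` in the Gaussian variables attached to the small coordinates. -/
theorem measure_cosAverage_largePart_le (hH : H.IsHadamard) (φ : J × κ → ℝ) (w : κ → ℝ) {B : ℝ}
    (hB : 0 ≤ B) {t : ℝ} (ht : 0 ≤ t) :
    (gaussianPi (J × κ)) {g | t ≤ |cosAverage H g φ w -
        Real.exp (-(∑ i, (w i - largePart B w i) ^ 2) / 2) * cosAverage H g φ (largePart B w)|} ≤
      ENNReal.ofReal (2 * Real.exp (-(2 * t ^ 2 * Fintype.card J / (Real.pi ^ 2 * B ^ 2)))) := by
  classical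
  set γ := gaussianPi (J × κ) with hγ
  set S := {g | t ≤ |cosAverage H g φ w -
    Real.exp (-(∑ i, (w i - largePart B w i) ^ 2) / 2) * cosAverage H g φ (largePart B w)|} with hS
  have hSm : MeasurableSet S :=
    (isClosed_le continuous_const (by fun_prop)).measurableSet
  -- Use the copy `Y` on the large coordinates and `X` on the others. For fixed `Y`, the transform
  -- of the large part is a deterministic phase, and concentration applies in `X`.
  have hmix := measurePreserving_mix (gaussianReal 0 1) (fun p : J × κ => B < |w p.2|)
  rw [← hmix.measure_preimage hSm.nullMeasurableSet,
    Measure.prod_apply_symm (hmix.measurable hSm)]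
  refine (lintegral_mono (g := fun _ => ENNReal.ofReal
    (2 * Real.exp (-(2 * t ^ 2 * Fintype.card J / (Real.pi ^ 2 * B ^ 2))))) fun Y => ?_).trans_eq
      (by simp)
  have hv : ∀ i, |(w - largePart B w) i| ≤ B := by
    intro i
    simp only [Pi.sub_apply, largePart]
    split_ifs with h
    · simpa using hB
    · simpa using h
  have key := measure_cosAverage_sub_le hH
    (fun q => transformEntry H Y (largePart B w) q + φ q) hv ht
  rw [measureReal_def] at key
  rw [← ENNReal.ofReal_toReal (measure_ne_top γ _)]
  refine ENNReal.ofReal_le_ofReal (le_trans (le_of_eq ?_) key)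
  refine congrArg (fun A => (γ A).toReal) (Set.ext fun X => ?_)
  set M : J × κ → ℝ := fun p => if B < |w p.2| then Y p else X p
  have e1 : ∀ q, transformEntry H M (largePart B w) q = transformEntry H Y (largePart B w) q := by
    intro q
    refine Finset.sum_congr rfl fun i _ => ?_
    simp only [M, largePart]
    split_ifs <;> simp
  have e2 : ∀ q, transformEntry H M (w - largePart B w) q =
      transformEntry H X (w - largePart B w) q := by
    intro q
    refine Finset.sum_congr rfl fun i _ => ?_
    simp only [M, largePart, Pi.sub_apply]
    split_ifs <;> simp
  have e3 : cosAverage H M φ w =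
      cosAverage H X (fun q => transformEntry H Y (largePart B w) q + φ q) (w - largePart B w) := by
    conv_lhs => rw [← sub_add_cancel w (largePart B w), cosAverage_add]
    simp only [cosAverage, e1, e2]
  have e4 : cosAverage H M φ (largePart B w) =
      cosAverage H 0 (fun q => transformEntry H Y (largePart B w) q + φ q) 0 := by
    conv_lhs => rw [← zero_add (largePart B w), cosAverage_add]
    simp only [cosAverage, e1, transformEntry_zero]
  change t ≤ |cosAverage H M φ w - _ * cosAverage H M φ (largePart B w)| ↔ t ≤ |_|
  rw [e3, e4]
  simp only [Pi.sub_apply]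

end CosineAverage

/-! ### Dyadic truncation and the sparse net -/

section Discretization

set_option linter.unusedSectionVars false

variable {J κ : Type*} [Fintype J] [Fintype κ] [DecidableEq κ]

theorem largePart_largePart {B B' : ℝ} (h : B' ≤ B) (w : κ → ℝ) :
    largePart B (largePart B' w) = largePart B w := by
  ext i
  by_cases h1 : B < |w i|
  · simp [largePart, h1, h.trans_lt h1]
  · by_cases h2 : B' < |w i|
    · simp [largePart, h1, h2]
    · simp [largePart, h1, h2]

/-- The two parts have disjoint supports. This makes the exponential factors of successive scales
multiply to that of the whole vector. -/
theorem sum_sub_largePart_sq (B : ℝ) (w : κ → ℝ) :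
    ∑ i, (w i - largePart B w i) ^ 2 = ∑ i, w i ^ 2 - ∑ i, largePart B w i ^ 2 := by
  rw [← Finset.sum_sub_distrib]
  refine Finset.sum_congr rfl fun i _ => ?_
  unfold largePart
  split_ifs <;> ring

/-- Chebyshev's inequality for counting measure; with `‖w‖ ≤ R` and `B = R/2^(s+1)` it yields the
sparsity `4^(s+1)`. -/
theorem card_support_largePart_mul_le {B : ℝ} (hB : 0 ≤ B) (w : κ → ℝ) :
    ((Finset.univ.filter fun i => largePart B w i ≠ 0).card : ℝ) * B ^ 2 ≤ ∑ i, w i ^ 2 := by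
  rw [← nsmul_eq_mul, ← Finset.sum_const]
  refine (Finset.sum_le_sum fun i hi => ?_).trans
    (Finset.sum_le_univ_sum_of_nonneg fun i => sq_nonneg (w i))
  simp only [largePart, Finset.mem_filter, ne_eq, ite_eq_right_iff, Classical.not_imp] at hi
  rw [← sq_abs (w i)]
  exact pow_le_pow_left₀ hB hi.2.1.le 2

/-- Telescoping over dyadic thresholds: if the passage from each truncation to the previous one
costs at most `t`, then `S` truncations cost at most `S * t`. -/
theorem abs_sub_exp_mul_le_of_largePart {F : (κ → ℝ) → ℝ} {z : κ → ℝ} {R t : ℝ} (hR : 0 ≤ R) {S : ℕ}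
    (hz : ∀ i, |z i| ≤ R) (hS : ∀ i, z i ≠ 0 → R / 2 ^ S < |z i|)
    (h : ∀ s < S, ∀ w, w = largePart (R / 2 ^ (s + 1)) z →
      |F w - Real.exp (-(∑ i, (w i - largePart (R / 2 ^ s) w i) ^ 2) / 2) *
        F (largePart (R / 2 ^ s) w)| ≤ t) :
    |F z - Real.exp (-(∑ i, z i ^ 2) / 2) * F 0| ≤ S * t := by
  have key : ∀ s ≤ S, |F (largePart (R / 2 ^ s) z) -
      Real.exp (-(∑ i, largePart (R / 2 ^ s) z i ^ 2) / 2) * F 0| ≤ s * t := by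
    intro s
    induction s with
    | zero =>
      intro _
      -- Truncation keeps only moduli strictly above the threshold, so the threshold `R` removes
      -- everything.
      have : largePart (R / 2 ^ 0) z = 0 := by
        ext i
        simp [largePart, not_lt.2 (hz i)]
      rw [this]
      simp
    | succ s ih =>
      intro hs
      have h1 := h s hs _ rfl
      have h2 := ih (Nat.le_of_succ_le hs)
      have hle : R / 2 ^ (s + 1) ≤ R / 2 ^ s := by
        gcongr
        · norm_num
        · omega
      rw [sum_sub_largePart_sq, largePart_largePart hle] at h1
      set w := largePart (R / 2 ^ (s + 1)) z
      set u := largePart (R / 2 ^ s) z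
      have hnn : ∑ i, u i ^ 2 ≤ ∑ i, w i ^ 2 := by
        refine Finset.sum_le_sum fun i _ => ?_
        by_cases hb : R / 2 ^ s < |z i|
        · simp [u, w, largePart, hb, hle.trans_lt hb]
        · simp [u, largePart, hb, sq_nonneg]
      set E := Real.exp (-(∑ i, w i ^ 2 - ∑ i, u i ^ 2) / 2)
      have hE : E ≤ 1 := Real.exp_le_one_iff.2 (by linarith)
      have hE0 : 0 ≤ E := (Real.exp_pos _).le
      have hEE : Real.exp (-(∑ i, w i ^ 2) / 2) = E * Real.exp (-(∑ i, u i ^ 2) / 2) := by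
        rw [← Real.exp_add]; ring_nf
      -- As `E ≤ 1`, errors from coarser scales are not amplified; they merely add.
      have : F w - Real.exp (-(∑ i, w i ^ 2) / 2) * F 0 =
          (F w - E * F u) + E * (F u - Real.exp (-(∑ i, u i ^ 2) / 2) * F 0) := by
        rw [hEE]; ring
      rw [this]
      refine (abs_add_le _ _).trans ?_
      rw [abs_mul, abs_of_nonneg hE0]
      have h3 : E * |F u - Real.exp (-(∑ i, u i ^ 2) / 2) * F 0| ≤ 1 * (s * t) :=
        mul_le_mul hE h2 (abs_nonneg _) zero_le_one
      push_cast
      linarith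
  have hzS : largePart (R / 2 ^ S) z = z := by
    ext i
    by_cases hi : z i = 0
    · simp [largePart, hi]
    · simp [largePart, hS i hi]
  simpa [hzS] using key S le_rfl

/-- The integer vector with `n` prescribed (position, value) contributions. -/
def sparseVector {K n : ℕ} (p : Fin n → κ × Finset.Icc (-(K : ℤ)) K) : κ → ℤ :=
  ∑ a, Pi.single (p a).1 ((p a).2 : ℤ)

theorem exists_sparseVector_eq [Nonempty κ] {K : ℕ} (n : ℕ) (k : κ → ℤ) (hk : ∀ i, |k i| ≤ K)
    (hn : (Finset.univ.filter fun i => k i ≠ 0).card ≤ n) :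
    ∃ p : Fin n → κ × Finset.Icc (-(K : ℤ)) K, sparseVector p = k := by
  induction n generalizing k with
  | zero =>
    refine ⟨Fin.elim0, ?_⟩
    ext i
    by_contra hi
    have := Finset.card_eq_zero.1 (Nat.le_zero.1 hn)
    have hmem : i ∈ Finset.univ.filter fun i => k i ≠ 0 := by
      simpa [sparseVector, eq_comm] using hi
    simp [this] at hmem
  | succ n ih =>
    -- Peel off a nonzero coordinate; if there is none, an arbitrary position with value 0 fills the
    -- slot.
    obtain ⟨i, hi⟩ : ∃ i, (∃ j, k j ≠ 0) → k i ≠ 0 := by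
      by_cases h : ∃ j, k j ≠ 0
      · exact ⟨h.choose, fun _ => h.choose_spec⟩
      · exact ⟨Classical.arbitrary κ, fun h' => (h h').elim⟩
    obtain ⟨p, hp⟩ := ih (Function.update k i 0) (fun j => by
        by_cases hj : j = i
        · subst hj; simp
        · simpa [hj] using hk j) (by
      by_cases h : ∃ j, k j ≠ 0
      · have hs : (Finset.univ.filter fun j => Function.update k i 0 j ≠ 0) ⊆
            (Finset.univ.filter fun j => k j ≠ 0).erase i := by
          intro j hj
          by_cases hji : j = i
          · subst hji; simp at hj
          · simpa [hji] using hj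
        refine (Finset.card_le_card hs).trans ?_
        rw [Finset.card_erase_of_mem (by simpa using hi h)]
        omega
      · push Not at h
        have : (Finset.univ.filter fun j => Function.update k i 0 j ≠ 0) = ∅ := by
          ext j
          by_cases hji : j = i
          · subst hji; simp
          · simp [hji, h j]
        simp [this])
    refine ⟨Fin.cons (i, ⟨k i, Finset.mem_Icc.2 (abs_le.1 (hk i))⟩) p, ?_⟩
    have : sparseVector (Fin.cons (i, ⟨k i, Finset.mem_Icc.2 (abs_le.1 (hk i))⟩) p) =
        Pi.single i (k i) + sparseVector p := by
      simp [sparseVector, Fin.sum_univ_succ]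
    rw [this, hp]
    ext j
    by_cases hji : j = i
    · subst hji; simp
    · simp [hji]

/-- Rounding towards zero to a multiple of `η`. -/
theorem exists_int_mul_abs_le {η : ℝ} (hη : 0 < η) (x : ℝ) :
    ∃ k : ℤ, |η * k| ≤ |x| ∧ |x - η * k| ≤ η := by
  wlog hx : 0 ≤ x generalizing x
  · obtain ⟨k, h1, h2⟩ := this (-x) (by linarith)
    refine ⟨-k, by simpa using h1, ?_⟩
    rw [← abs_neg] at h2
    convert h2 using 2
    push_cast
    ring
  have hx' : x = η * (x / η) := by field_simp
  have h1 := mul_le_mul_of_nonneg_left (Int.floor_le (x / η)) hη.le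
  have h2 := mul_le_mul_of_nonneg_left (Int.lt_floor_add_one (x / η)).le hη.le
  have h3 : (0 : ℝ) ≤ ⌊x / η⌋ := by exact_mod_cast Int.floor_nonneg.2 (by positivity)
  refine ⟨⌊x / η⌋, ?_, ?_⟩
  · rw [abs_of_nonneg (by positivity), abs_of_nonneg hx]
    linarith
  · rw [abs_le]
    constructor <;> linarith

/-- The entries of `H` have modulus 1, so entry `(j, k)` moves by at most `η ∑ i, |g (j, i)|`, and
summing over `k` counts each `|g (j, i)|` exactly `card κ` times. -/
theorem abs_cosAverage_sub_cosAverage_le {H : Matrix κ κ ℝ} (hH : H.IsHadamard)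
    {g : J × κ → ℝ} (φ : J × κ → ℝ) {z z' : κ → ℝ} {η : ℝ}
    (h : ∀ i, |z i - z' i| ≤ η) (hg : ∑ p, |g p| ≤ 3 * Fintype.card (J × κ)) :
    |cosAverage H g φ z - cosAverage H g φ z'| ≤ 3 * Fintype.card κ * η := by
  have habs : ∀ k i, |H k i| = 1 := fun k i => by
    have := isHadamard_apply_sq hH k i
    rw [← sq_abs] at this
    exact (pow_eq_one_iff_of_nonneg (abs_nonneg _) two_ne_zero).1 this
  rcases isEmpty_or_nonempty κ with hκ | ⟨⟨i₀⟩⟩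
  · simp [cosAverage]
  have hη : 0 ≤ η := (abs_nonneg _).trans (h i₀)
  have hq : ∀ q : J × κ, |Real.cos (transformEntry H g z q + φ q) -
      Real.cos (transformEntry H g z' q + φ q)| ≤ ∑ i, |g (q.1, i)| * η := by
    intro q
    refine (Real.abs_cos_sub_cos_le _ _).trans ?_
    rw [add_sub_add_right_eq_sub, ← transformEntry_sub]
    refine (Finset.abs_sum_le_sum_abs _ _).trans (Finset.sum_le_sum fun i _ => ?_)
    rw [abs_mul, abs_mul, habs, one_mul]
    exact mul_le_mul_of_nonneg_left (h i) (abs_nonneg _)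
  have hsum : ∑ q : J × κ, ∑ i, |g (q.1, i)| * η = Fintype.card κ * η * ∑ p, |g p| := by
    rw [Fintype.sum_prod_type, Fintype.sum_prod_type, Finset.mul_sum]
    refine Finset.sum_congr rfl fun j _ => ?_
    simp only [Finset.sum_const, Finset.card_univ, nsmul_eq_mul, ← Finset.sum_mul]
    ring
  rw [cosAverage, cosAverage, ← mul_sub, ← Finset.sum_sub_distrib, abs_mul,
    abs_of_nonneg (by positivity)]
  rcases (Nat.cast_nonneg (α := ℝ) (Fintype.card (J × κ))).eq_or_lt with h0 | h0
  · rw [← h0]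
    simp only [inv_zero, zero_mul]
    positivity
  rw [inv_mul_le_iff₀ h0]
  refine (Finset.abs_sum_le_sum_abs _ _).trans ((Finset.sum_le_sum fun q _ => hq q).trans ?_)
  rw [hsum]
  calc Fintype.card κ * η * ∑ p, |g p|
      ≤ Fintype.card κ * η * (3 * Fintype.card (J × κ)) := by gcongr
    _ = _ := by ring

/-- A grid vector `η • sparseVector p`. -/
def gridVector (η : ℝ) {K n : ℕ} (p : Fin n → κ × Finset.Icc (-(K : ℤ)) K) (i : κ) : ℝ :=
  η * (sparseVector p i : ℝ)

theorem abs_exp_neg_half_sub_le {a b : ℝ} (hb : 0 ≤ b) (hab : b ≤ a) :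
    |Real.exp (-a / 2) - Real.exp (-b / 2)| ≤ (a - b) / 2 := by
  have h1 : Real.exp (-a / 2) ≤ Real.exp (-b / 2) := Real.exp_le_exp.2 (by linarith)
  rw [abs_sub_comm, abs_of_nonneg (by linarith)]
  have h2 : Real.exp (-a / 2) = Real.exp (-b / 2) * Real.exp (-((a - b) / 2)) := by
    rw [← Real.exp_add]; ring_nf
  have h3 := Real.add_one_le_exp (-((a - b) / 2))
  have h4 : Real.exp (-b / 2) ≤ 1 := Real.exp_le_one_iff.2 (by linarith)
  have h5 := Real.exp_pos (-b / 2)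
  rw [h2]
  nlinarith

/-- From the net to the whole ball of radius `R`. -/
theorem abs_cosAverage_sub_exp_mul_le [Nonempty κ] {H : Matrix κ κ ℝ} (hH : H.IsHadamard)
    {g φ : J × κ → ℝ} {R η t : ℝ} {S K : ℕ} (hR : 0 < R) (hη : 0 < η) (hS : R / 2 ^ S < η)
    (hK : R / η ≤ K) (hg : ∑ p, |g p| ≤ 3 * Fintype.card (J × κ))
    (hnet : ∀ s < S, ∀ p : Fin (4 ^ (s + 1)) → κ × Finset.Icc (-(K : ℤ)) K,
      |cosAverage H g φ (gridVector η p) - Real.exp (-(∑ i, (gridVector η p i -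
        largePart (R / 2 ^ s) (gridVector η p) i) ^ 2) / 2) *
          cosAverage H g φ (largePart (R / 2 ^ s) (gridVector η p))| ≤ t)
    {z : κ → ℝ} (hz : ∑ i, z i ^ 2 ≤ R ^ 2) :
    |cosAverage H g φ z - Real.exp (-(∑ i, z i ^ 2) / 2) * cosAverage H g φ 0| ≤
      S * t + 3 * Fintype.card κ * η + Fintype.card κ * (η * R) := by
  -- Rounding towards zero keeps the rounded vector in the ball, so its truncations stay as sparse
  -- as required.
  choose k hk1 hk2 using fun i => exists_int_mul_abs_le hη (z i)
  set z' : κ → ℝ := fun i => η * k i with hz'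
  have hzR : ∀ i, |z i| ≤ R := fun i => by
    rw [← abs_of_pos hR]
    exact sq_le_sq.1 ((Finset.single_le_sum (f := fun i => z i ^ 2)
      (fun i _ => sq_nonneg _) (Finset.mem_univ i)).trans hz)
  have hz'R : ∀ i, |z' i| ≤ R := fun i => (hk1 i).trans (hzR i)
  have hsq : ∀ i, z' i ^ 2 ≤ z i ^ 2 := fun i => sq_le_sq.2 (hk1 i)
  have hz'sq : ∑ i, z' i ^ 2 ≤ ∑ i, z i ^ 2 := Finset.sum_le_sum fun i _ => hsq i
  have hkK : ∀ i, |k i| ≤ K := fun i => by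
    have h1 : η * |(k i : ℝ)| ≤ R := by
      have := hz'R i
      simpa only [hz', abs_mul, abs_of_pos hη] using this
    have h2 : |(k i : ℝ)| ≤ K := ((le_div_iff₀' hη).2 h1).trans hK
    exact_mod_cast h2
  have hchain : |cosAverage H g φ z' - Real.exp (-(∑ i, z' i ^ 2) / 2) * cosAverage H g φ 0| ≤
      S * t := by
    refine abs_sub_exp_mul_le_of_largePart hR.le hz'R (fun i hi => ?_) fun s hs w hw => ?_
    · have hki : k i ≠ 0 := by rintro h; simp [hz', h] at hi
      -- A nonzero grid coordinate is at least `η`, hence survives the finest truncation.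
      refine hS.trans_le ?_
      have : (1 : ℝ) ≤ |(k i : ℝ)| := by exact_mod_cast Int.one_le_abs hki
      simp only [hz', abs_mul, abs_of_pos hη]
      nlinarith
    · set B := R / 2 ^ (s + 1)
      have hB : 0 < B := by positivity
      obtain ⟨p, hp⟩ := exists_sparseVector_eq (K := K) (4 ^ (s + 1))
        (fun i => if B < |z' i| then k i else 0)
        (fun i => by split_ifs; exacts [hkK i, by simp]) (by
          have hcard := card_support_largePart_mul_le hB.le z'
          have hsub : (Finset.univ.filter fun i => (if B < |z' i| then k i else 0) ≠ 0) ⊆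
              Finset.univ.filter fun i => largePart B z' i ≠ 0 := by
            intro i hi
            simp only [Finset.mem_filter, Finset.mem_univ, true_and, ne_eq, ite_eq_right_iff,
              Classical.not_imp, largePart] at hi ⊢
            exact ⟨hi.1, by simp [hz', hη.ne', hi.2]⟩
          refine (Finset.card_le_card hsub).trans ?_
          have h4 : R ^ 2 = 4 ^ (s + 1) * B ^ 2 := by
            simp only [B, div_pow, ← pow_mul]
            rw [mul_comm (s + 1) 2, pow_mul]
            norm_num
            field_simp
          have h5 := hcard.trans (hz'sq.trans hz)
          rw [h4] at h5
          exact_mod_cast le_of_mul_le_mul_right h5 (by positivity))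
      have : w = gridVector η p := by
        rw [hw]
        ext i
        simp only [gridVector, hp, largePart]
        split_ifs <;> simp [hz']
      rw [this]
      exact hnet s hs p
  have hlip := abs_cosAverage_sub_cosAverage_le hH φ hk2 hg
  have hexp : |Real.exp (-(∑ i, z i ^ 2) / 2) - Real.exp (-(∑ i, z' i ^ 2) / 2)| ≤
      Fintype.card κ * (η * R) := by
    refine (abs_exp_neg_half_sub_le (Finset.sum_nonneg fun i _ => sq_nonneg _) hz'sq).trans ?_
    rw [← Finset.sum_sub_distrib, div_le_iff₀ two_pos]
    refine (Finset.sum_le_sum (g := fun _ => η * R * 2) fun i _ => ?_).trans (by simp [mul_assoc])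
    have h1 := abs_le.1 (hk2 i)
    have h2 := abs_le.1 (hzR i)
    have h3 := abs_le.1 (hz'R i)
    calc z i ^ 2 - z' i ^ 2 = (z i - z' i) * (z i + z' i) := by ring
      _ ≤ |z i - z' i| * |z i + z' i| := by rw [← abs_mul]; exact le_abs_self _
      _ ≤ η * (R * 2) := by
        refine mul_le_mul (hk2 i) ?_ (abs_nonneg _) hη.le
        exact (abs_add_le _ _).trans (by linarith [hzR i, hz'R i])
      _ = _ := by ring
  have h0 : |cosAverage H g φ 0| ≤ 1 := abs_cosAverage_le_one
  have hexp' : |(Real.exp (-(∑ i, z' i ^ 2) / 2) - Real.exp (-(∑ i, z i ^ 2) / 2)) *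
      cosAverage H g φ 0| ≤ Fintype.card κ * (η * R) := by
    rw [abs_mul, abs_sub_comm]
    exact (mul_le_of_le_one_right (abs_nonneg _) h0).trans hexp
  calc _ = |(cosAverage H g φ z' - Real.exp (-(∑ i, z' i ^ 2) / 2) * cosAverage H g φ 0) +
        (cosAverage H g φ z - cosAverage H g φ z') +
        (Real.exp (-(∑ i, z' i ^ 2) / 2) - Real.exp (-(∑ i, z i ^ 2) / 2)) *
          cosAverage H g φ 0| := by ring_nf
    _ ≤ _ := (abs_add_three _ _ _).trans (add_le_add_three hchain hlip hexp')

end Discretization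

/-! ### Tail bounds and translation invariance of the phases -/

section Tails

variable {ι : Type*} [Fintype ι]

/-- Chernoff at parameter 1: since `E exp|x| ≤ exp 2` for each coordinate, the level 3 leaves `exp(2
- 3)` per coordinate. -/
theorem measure_sum_abs_gaussianPi_le :
    (gaussianPi ι) {x | 3 * (Fintype.card ι : ℝ) ≤ ∑ i, |x i|} ≤
      ENNReal.ofReal (Real.exp (-(Fintype.card ι : ℝ))) := by
  have hint : Integrable (fun x : ℝ => Real.exp |x|) (gaussianReal 0 1) := by
    have := integrable_exp_mul_abs (X := id) (t := 1) (μ := gaussianReal 0 1)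
      (by simpa using integrable_exp_mul_gaussianReal (μ := 0) (v := 1) 1)
      (by simpa using integrable_exp_mul_gaussianReal (μ := 0) (v := 1) (-1))
    simpa using this
  have hone : ∫ x, Real.exp |x| ∂gaussianReal 0 1 ≤ Real.exp 2 := by
    have hI : ∀ t : ℝ, Integrable (fun x : ℝ => Real.exp (t * x)) (gaussianReal 0 1) := fun t =>
      integrable_exp_mul_gaussianReal t
    have hv : ∀ t : ℝ, ∫ x, Real.exp (t * x) ∂gaussianReal 0 1 = Real.exp (t ^ 2 / 2) := fun t => by
      have := mgf_gaussianReal (p := gaussianReal 0 1) (X := id) (μ := 0) (v := 1) (by simp) t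
      simpa [mgf] using this
    calc ∫ x, Real.exp |x| ∂gaussianReal 0 1
        ≤ ∫ x, (Real.exp (1 * x) + Real.exp (-1 * x)) ∂gaussianReal 0 1 := by
          refine integral_mono hint ((hI 1).add (hI (-1))) fun x => ?_
          rcases abs_cases x with h | h <;> rw [h.1] <;>
            simp [(Real.exp_pos _).le]
      _ = 2 * Real.exp (1 / 2) := by
          rw [integral_add (hI 1) (hI (-1)), hv, hv]
          norm_num
          ring
      _ ≤ Real.exp (3 / 2) * Real.exp (1 / 2) := by
          gcongr
          have := Real.add_one_le_exp (3 / 2 : ℝ)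
          linarith
      _ = Real.exp 2 := by rw [← Real.exp_add]; norm_num
  have h := measure_ge_le_exp_mul_mgf (μ := gaussianPi ι) (X := fun x => ∑ i, |x i|) (t := 1)
    (3 * (Fintype.card ι : ℝ)) zero_le_one (by
      simp only [one_mul, Real.exp_sum]
      exact Integrable.fintype_prod (f := fun _ (x : ℝ) => Real.exp |x|) fun _ => hint)
  rw [← ENNReal.ofReal_toReal (measure_ne_top (gaussianPi ι) _)]
  refine ENNReal.ofReal_le_ofReal (h.trans ?_)
  simp only [mgf, one_mul, Real.exp_sum]
  rw [integral_fintype_prod_eq_prod (f := fun _ (x : ℝ) => Real.exp |x|), Finset.prod_const,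
    Finset.card_univ]
  calc _ ≤ Real.exp (-1 * (3 * (Fintype.card ι : ℝ))) * Real.exp 2 ^ Fintype.card ι := by
        gcongr
    _ = _ := by rw [← Real.exp_nat_mul, ← Real.exp_add]; ring_nf

/-- The uniform law on `[0, 2π]`. -/
noncomputable abbrev uniformPhase : Measure ℝ := cond volume (Set.Icc 0 (2 * Real.pi))

instance : IsProbabilityMeasure uniformPhase :=
  cond_isProbabilityMeasure_of_finite (by simp [Real.pi_pos])
    (by rw [Real.volume_Icc]; exact ENNReal.ofReal_ne_top)

/-- The law of independent phases, uniform on `[0, 2π]`. -/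
noncomputable abbrev phasePi (ι : Type*) [Fintype ι] : Measure (ι → ℝ) :=
  Measure.pi fun _ => uniformPhase

theorem integral_cos_two_mul_uniformPhase : ∫ x, Real.cos (2 * x) ∂uniformPhase = 0 := by
  rw [uniformPhase, ProbabilityTheory.cond, integral_smul_measure, integral_Icc_eq_integral_Ioc,
    ← intervalIntegral.integral_of_le (by positivity),
    intervalIntegral.integral_comp_mul_left (fun x => Real.cos x) two_ne_zero, integral_cos]
  have : Real.sin (2 * (2 * Real.pi)) = 0 := by
    have := Real.sin_nat_mul_pi 4
    rw [← this]
    congr 1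
    push_cast
    ring
  simp [this]

/-- At `z = 0` only independent bounded variables `cos(2b)` of mean zero remain, so Hoeffding
applies. -/
theorem measure_cosAverage_phase_le {J κ : Type*} [Fintype J] [Fintype κ] (H : Matrix κ κ ℝ)
    {t : ℝ} (ht : 0 ≤ t) :
    (phasePi (J × κ)) {b | t ≤ |cosAverage H 0 (fun q => 2 * b q) 0|} ≤
      ENNReal.ofReal (2 * Real.exp (-(Fintype.card (J × κ) * t ^ 2 / 2))) := by
  obtain ⟨N, hN⟩ : ∃ N : ℝ, N = (Fintype.card (J × κ) : ℝ) := ⟨_, rfl⟩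
  have hN0 : 0 ≤ N := hN ▸ Nat.cast_nonneg _
  rw [← hN]
  rcases hN0.eq_or_lt with h0 | hpos
  · rw [← h0]
    refine prob_le_one.trans ?_
    rw [ENNReal.one_le_ofReal]
    norm_num
  have hs : HasSubgaussianMGF (fun x : ℝ => Real.cos (2 * x)) 1 uniformPhase := by
    have := hasSubgaussianMGF_of_mem_Icc_of_integral_eq_zero (μ := uniformPhase)
      (X := fun x => Real.cos (2 * x)) (a := -1) (b := 1) (by fun_prop)
      (ae_of_all _ fun x => Real.cos_mem_Icc _) integral_cos_two_mul_uniformPhase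
    convert this using 1
    ext
    simp
    norm_num
  have hind : iIndepFun (fun (q : J × κ) (b : J × κ → ℝ) => Real.cos (2 * b q))
      (phasePi (J × κ)) :=
    iIndepFun_pi (X := fun _ x => Real.cos (2 * x)) fun _ => by fun_prop
  have hq : ∀ q : J × κ, HasSubgaussianMGF (fun b : J × κ → ℝ => Real.cos (2 * b q)) 1
      (phasePi (J × κ)) := by
    intro q
    have hm := (measurePreserving_eval (fun _ : J × κ => uniformPhase) q).map_eq
    rw [← hm] at hs
    exact HasSubgaussianMGF.of_map (Y := fun b : J × κ → ℝ => b q)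
      (measurable_pi_apply q).aemeasurable hs
  have hsum := HasSubgaussianMGF.sum_of_iIndepFun hind (s := Finset.univ) fun q _ => hq q
  have hNt : 0 ≤ N * t := by positivity
  have hp := hsum.measure_ge_le hNt
  have hn := hsum.neg.measure_ge_le hNt
  have e : -(N * t) ^ 2 / (2 * ((∑ _ : J × κ, (1 : NNReal) : NNReal) : ℝ)) = -(N * t ^ 2 / 2) := by
    simp only [Finset.sum_const, Finset.card_univ, nsmul_eq_mul, mul_one, NNReal.coe_natCast, ← hN]
    field_simp
  rw [e] at hp hn
  rw [← ENNReal.ofReal_toReal (measure_ne_top (phasePi (J × κ)) _)]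
  refine ENNReal.ofReal_le_ofReal (le_trans (measureReal_mono (fun b hb => ?_))
    ((measureReal_union_le _ _).trans ((add_le_add hp hn).trans_eq (two_mul _).symm)))
  rw [Set.mem_ofPred_eq] at hb
  simp only [cosAverage, transformEntry_zero, zero_add, ← hN, abs_mul, abs_inv,
    abs_of_pos hpos] at hb
  rw [le_inv_mul_iff₀ hpos] at hb
  exact le_abs.1 hb

/-- Up to null endpoints, `[0, 2π]` and its translate by `c` are both fundamental domains for `2πℤ`,
so they give equal measure to every periodic set. -/
theorem measurePreserving_fract_uniformPhase (c : ℝ) :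
    MeasurePreserving (fun x => 2 * Real.pi * Int.fract ((x + c) / (2 * Real.pi)))
      uniformPhase uniformPhase := by
  have hT : 0 < 2 * Real.pi := by positivity
  set T := 2 * Real.pi
  have hm : Measurable fun x => T * Int.fract ((x + c) / T) := by fun_prop
  refine ⟨hm, ?_⟩
  ext E hE
  rw [Measure.map_apply hm hE, uniformPhase, cond_apply measurableSet_Icc,
    cond_apply measurableSet_Icc]
  congr 1
  set A := (fun x => T * Int.fract (x / T)) ⁻¹' E with hA
  have hAm : MeasurableSet A := (by fun_prop : Measurable fun x => T * Int.fract (x / T)) hE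
  have hinv : ∀ a : AddSubgroup.zmultiples T, (fun x => a +ᵥ x) ⁻¹' A = A := by
    rintro ⟨_, ⟨n, rfl⟩⟩
    ext x
    simp only [hA, Set.mem_preimage, AddSubgroup.mk_vadd, vadd_eq_add, zsmul_eq_mul]
    rw [add_div, mul_div_assoc, div_self hT.ne', mul_one, Int.fract_intCast_add]
  have hfd := (isAddFundamentalDomain_Ioc hT c).measure_set_eq (isAddFundamentalDomain_Ioc hT 0)
    hAm hinv
  have h1 : Set.Icc 0 T ∩ (fun x => T * Int.fract ((x + c) / T)) ⁻¹' E =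
      (fun x => x + c) ⁻¹' (A ∩ Set.Icc c (c + T)) := by
    ext x
    simp only [hA, Set.mem_inter_iff, Set.mem_preimage, Set.mem_Icc]
    constructor
    · rintro ⟨⟨h1, h2⟩, h3⟩
      exact ⟨h3, by linarith, by linarith⟩
    · rintro ⟨h3, h1, h2⟩
      exact ⟨⟨by linarith, by linarith⟩, h3⟩
  have h2 : Set.Ico 0 T ∩ E = A ∩ Set.Ico 0 T := by
    ext x
    simp only [hA, Set.mem_inter_iff, Set.mem_preimage]
    rw [and_comm]
    refine and_congr_left fun hx => ?_
    rw [Int.fract_eq_self.2 ⟨div_nonneg hx.1 hT.le, (div_lt_one hT).2 hx.2⟩, mul_div_cancel₀ _ hT.ne']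
  rw [h1, measure_preimage_add_right]
  have ae1 : (A ∩ Set.Icc c (c + T) : Set ℝ) =ᵐ[volume] (A ∩ Set.Ioc c (c + T) : Set ℝ) :=
    (Filter.EventuallyEq.refl _ A).inter Ioc_ae_eq_Icc.symm
  have ae2 : (A ∩ Set.Ioc 0 (0 + T) : Set ℝ) =ᵐ[volume] (A ∩ Set.Ico 0 T : Set ℝ) := by
    rw [zero_add]
    exact (Filter.EventuallyEq.refl _ A).inter (Ioc_ae_eq_Icc.trans Ico_ae_eq_Icc.symm)
  have ae3 : (Set.Icc 0 T ∩ E : Set ℝ) =ᵐ[volume] (Set.Ico 0 T ∩ E : Set ℝ) :=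
    Ico_ae_eq_Icc.symm.inter (Filter.EventuallyEq.refl _ E)
  rw [measure_congr ae1, hfd, measure_congr ae2, measure_congr ae3, h2]

/-- Uniform phases are invariant under translation, as far as periodic events are concerned. -/
theorem phasePi_preimage_add (c : ι → ℝ) {S : Set (ι → ℝ)} (hS : MeasurableSet S)
    (hper : ∀ (b : ι → ℝ) (n : ι → ℤ), (fun i => b i - 2 * Real.pi * n i) ∈ S ↔ b ∈ S) :
    (phasePi ι) {b | b + c ∈ S} = (phasePi ι) S := by
  have hmp : MeasurePreserving
      (fun (b : ι → ℝ) i => 2 * Real.pi * Int.fract ((b i + c i) / (2 * Real.pi)))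
      (phasePi ι) (phasePi ι) :=
    measurePreserving_pi _ _ fun i => measurePreserving_fract_uniformPhase (c i)
  rw [← hmp.measure_preimage hS.nullMeasurableSet]
  congr 1
  ext b
  rw [Set.mem_preimage, Set.mem_ofPred_eq, ← hper (b + c) fun i => ⌊(b i + c i) / (2 * Real.pi)⌋]
  have : (fun i => (b + c) i - 2 * Real.pi * (⌊(b i + c i) / (2 * Real.pi)⌋ : ℤ)) =
      fun i => 2 * Real.pi * Int.fract ((b i + c i) / (2 * Real.pi)) := by
    ext i
    have := Real.pi_pos
    rw [Int.fract, Pi.add_apply]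
    field_simp
  rw [this]

/-- The shift may depend on the Gaussians: by Fubini it is constant on each fibre. -/
theorem prod_phasePi_preimage_add {α : Type*} [MeasurableSpace α] (ν : Measure α)
    [IsProbabilityMeasure ν] {a : α → ι → ℝ} (ha : Measurable a) {S : Set (α × (ι → ℝ))}
    (hS : MeasurableSet S)
    (hper : ∀ x (b : ι → ℝ) (n : ι → ℤ), (x, fun i => b i - 2 * Real.pi * n i) ∈ S ↔ (x, b) ∈ S) :
    (ν.prod (phasePi ι)) {p | (p.1, p.2 + a p.1) ∈ S} = (ν.prod (phasePi ι)) S := by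
  have hm : Measurable fun p : α × (ι → ℝ) => (p.1, p.2 + a p.1) := by fun_prop
  change (ν.prod (phasePi ι)) ((fun p => (p.1, p.2 + a p.1)) ⁻¹' S) = _
  rw [Measure.prod_apply (hm hS), Measure.prod_apply hS]
  refine lintegral_congr fun x => ?_
  exact phasePi_preimage_add (a x) (S := Prod.mk x ⁻¹' S) (measurable_prodMk_left hS)
    fun b n => hper x b n

end Tails

/-! ### Union bounds and the exceptional event -/

section UniformBound

set_option linter.unusedSectionVars false

variable {J κ : Type*} [Fintype J] [Fintype κ] [DecidableEq κ]

/-- The deviation of `cosAverage` caused by restoring the coordinates of `w` below `B`. -/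
noncomputable def truncationError (H : Matrix κ κ ℝ) (g φ : J × κ → ℝ) (B : ℝ) (w : κ → ℝ) : ℝ :=
  |cosAverage H g φ w - Real.exp (-(∑ i, (w i - largePart B w i) ^ 2) / 2) *
    cosAverage H g φ (largePart B w)|

/-- Some truncation of some vector of the net has a deviation of at least `t`. -/
def NetFailure (H : Matrix κ κ ℝ) (R η t : ℝ) (S K : ℕ) (g φ : J × κ → ℝ) : Prop :=
  ∃ s < S, ∃ p : Fin (4 ^ (s + 1)) → κ × Finset.Icc (-(K : ℤ)) K,
    t ≤ truncationError H g φ (R / 2 ^ s) (gridVector η p)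

theorem isClosed_netFailure {X : Type*} [TopologicalSpace X] (H : Matrix κ κ ℝ) (R η t : ℝ)
    (S K : ℕ) {a b : X → J × κ → ℝ} (ha : Continuous a) (hb : Continuous b) :
    IsClosed {x | NetFailure H R η t S K (a x) (b x)} := by
  have : {x | NetFailure H R η t S K (a x) (b x)} =
      ⋃ s ∈ Set.Iio S, ⋃ p : Fin (4 ^ (s + 1)) → κ × Finset.Icc (-(K : ℤ)) K,
        {x | t ≤ truncationError H (a x) (b x) (R / 2 ^ s) (gridVector η p)} := by
    ext x
    simp [NetFailure]
  rw [this]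
  refine (Set.finite_Iio S).isClosed_biUnion fun s _ => isClosed_iUnion_of_finite fun p => ?_
  refine isClosed_le continuous_const ?_
  unfold truncationError
  fun_prop

/-- At scale `s` the net has at most `exp(4A · 4^s)` elements, each failing with probability at most
`2 exp(-Q · 4^s)`. Since `4^s ≥ 1`, the margin `Q - 4A` gives `δ/S` at every scale. -/
theorem measure_netFailure_le {H : Matrix κ κ ℝ} (hH : H.IsHadamard) (φ : J × κ → ℝ)
    {R η t A δ : ℝ} {S K : ℕ} (hR : 0 < R) (ht : 0 ≤ t) (hS : 0 < S) (hδ : 0 < δ) (hδ1 : δ ≤ 1)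
    (hA : (Fintype.card κ : ℝ) * (2 * K + 1) ≤ Real.exp A)
    (hQ : 4 * A + Real.log (2 * S / δ) ≤ 2 * t ^ 2 * Fintype.card J / (Real.pi ^ 2 * R ^ 2)) :
    (gaussianPi (J × κ)) {g | NetFailure H R η t S K g φ} ≤ ENNReal.ofReal δ := by
  set Q := 2 * t ^ 2 * Fintype.card J / (Real.pi ^ 2 * R ^ 2) with hQdef
  have hS' : (0 : ℝ) < S := by exact_mod_cast hS
  have hS1 : (1 : ℝ) ≤ S := by exact_mod_cast hS
  have hlog : 0 ≤ Real.log (2 * S / δ) := Real.log_nonneg (by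
    rw [le_div_iff₀ hδ]; linarith)
  have hset : {g | NetFailure H R η t S K g φ} =
      ⋃ s ∈ Finset.range S, ⋃ p : Fin (4 ^ (s + 1)) → κ × Finset.Icc (-(K : ℤ)) K,
        {g | t ≤ truncationError H g φ (R / 2 ^ s) (gridVector η p)} := by
    ext x
    simp [NetFailure]
  have hlevel : ∀ s, (gaussianPi (J × κ))
      (⋃ p : Fin (4 ^ (s + 1)) → κ × Finset.Icc (-(K : ℤ)) K,
        {g | t ≤ truncationError H g φ (R / 2 ^ s) (gridVector η p)}) ≤ ENNReal.ofReal (δ / S) := by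
    intro s
    have hB : 0 ≤ R / 2 ^ s := by positivity
    refine (measure_iUnion_fintype_le _ _).trans
      ((Finset.sum_le_sum fun p _ => measure_cosAverage_largePart_le hH φ _ hB ht).trans ?_)
    rw [Finset.sum_const, nsmul_eq_mul, ← ENNReal.ofReal_natCast,
      ← ENNReal.ofReal_mul (Nat.cast_nonneg _)]
    refine ENNReal.ofReal_le_ofReal ?_
    have hcard : ((Finset.univ : Finset (Fin (4 ^ (s + 1)) → κ × Finset.Icc (-(K : ℤ)) K)).card : ℝ)
        = ((Fintype.card κ : ℝ) * (2 * K + 1)) ^ (4 ^ (s + 1)) := by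
      have : ((K : ℤ) + 1 - -K).toNat = 2 * K + 1 := by omega
      rw [Finset.card_univ]
      simp only [Fintype.card_fun, Fintype.card_fin, Fintype.card_prod, Fintype.card_coe,
        Int.card_Icc, this]
      push_cast
      rfl
    rw [hcard]
    have hQs : 2 * t ^ 2 * Fintype.card J / (Real.pi ^ 2 * (R / 2 ^ s) ^ 2) = Q * 4 ^ s := by
      have h4 : (4 : ℝ) ^ s = (2 ^ s) ^ 2 := by rw [← pow_mul, mul_comm, pow_mul]; norm_num
      have := Real.pi_pos
      rw [hQdef, h4]
      field_simp
    rw [hQs]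
    have h1 : (1 : ℝ) ≤ 4 ^ s := one_le_pow₀ (by norm_num)
    calc ((Fintype.card κ : ℝ) * (2 * K + 1)) ^ (4 ^ (s + 1)) * (2 * Real.exp (-(Q * 4 ^ s)))
        ≤ Real.exp A ^ (4 ^ (s + 1)) * (2 * Real.exp (-(Q * 4 ^ s))) := by gcongr
      _ = 2 * Real.exp (-((Q - 4 * A) * 4 ^ s)) := by
          rw [← Real.exp_nat_mul, mul_left_comm, ← Real.exp_add]
          congr 2
          push_cast
          ring
      _ ≤ 2 * Real.exp (-Real.log (2 * S / δ)) := by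
          gcongr
          nlinarith
      _ = δ / S := by
          rw [Real.exp_neg, Real.exp_log (by positivity)]
          field_simp
  rw [hset]
  refine (measure_biUnion_finset_le _ _).trans ((Finset.sum_le_sum fun s _ => hlevel s).trans ?_)
  rw [Finset.sum_const, nsmul_eq_mul, Finset.card_range, ← ENNReal.ofReal_natCast,
    ← ENNReal.ofReal_mul (Nat.cast_nonneg _), mul_div_cancel₀ _ hS'.ne']

theorem cosAverage_sub_two_pi_mul (H : Matrix κ κ ℝ) (g : J × κ → ℝ) (b : J × κ → ℝ)
    (n : J × κ → ℤ) (z : κ → ℝ) :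
    cosAverage H g (fun q => 2 * (b q - 2 * Real.pi * n q)) z =
      cosAverage H g (fun q => 2 * b q) z := by
  unfold cosAverage
  congr 1
  refine Finset.sum_congr rfl fun q _ => ?_
  have := Real.cos_sub_int_mul_two_pi (transformEntry H g z q + 2 * b q) (2 * n q)
  rw [← this]
  congr 1
  push_cast
  ring

/-- The exceptional event for diagonals `g`, phases `b` and a centre `c`. -/
def ExceptionalEvent (H : Matrix κ κ ℝ) (R η t t' : ℝ) (S K : ℕ) (c : κ → ℝ) :
    Set ((J × κ → ℝ) × (J × κ → ℝ)) :=
  {x | 3 * (Fintype.card (J × κ) : ℝ) ≤ ∑ p, |x.1 p|} ∪ {x | NetFailure H R η t S K x.1 0} ∪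
    {x | NetFailure H R η t S K x.1 (fun q => 2 * (x.2 q + transformEntry H x.1 c q)) ∨
      t' ≤ |cosAverage H 0 (fun q => 2 * (x.2 q + transformEntry H x.1 c q)) 0|}

theorem measurableSet_exceptionalEvent (H : Matrix κ κ ℝ) (R η t t' : ℝ) (S K : ℕ) (c : κ → ℝ) :
    MeasurableSet (ExceptionalEvent (J := J) H R η t t' S K c) := by
  have h1 : IsClosed {x : (J × κ → ℝ) × (J × κ → ℝ) |
      3 * (Fintype.card (J × κ) : ℝ) ≤ ∑ p, |x.1 p|} :=
    isClosed_le continuous_const (by fun_prop)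
  have h2 : IsClosed {x : (J × κ → ℝ) × (J × κ → ℝ) | NetFailure H R η t S K x.1 0} :=
    isClosed_netFailure H R η t S K continuous_fst continuous_const
  have h3 : Continuous fun x : (J × κ → ℝ) × (J × κ → ℝ) =>
      fun q => 2 * (x.2 q + transformEntry H x.1 c q) := by fun_prop
  have h4 := isClosed_netFailure H R η t S K continuous_fst h3
  have h5 : IsClosed {x : (J × κ → ℝ) × (J × κ → ℝ) |
      t' ≤ |cosAverage H 0 (fun q => 2 * (x.2 q + transformEntry H x.1 c q)) 0|} :=
    isClosed_le continuous_const (continuous_cosAverage continuous_const h3 0).abs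
  exact ((h1.union h2).union (h4.union h5)).measurableSet

theorem measure_exceptionalEvent_le {H : Matrix κ κ ℝ} (hH : H.IsHadamard)
    {R η t t' A δ : ℝ} {S K : ℕ} (hR : 0 < R) (ht : 0 ≤ t) (ht' : 0 ≤ t') (hS : 0 < S) (hδ : 0 < δ)
    (hδ1 : δ ≤ 1) (hA : (Fintype.card κ : ℝ) * (2 * K + 1) ≤ Real.exp A)
    (hQ : 4 * A + Real.log (2 * S / δ) ≤ 2 * t ^ 2 * Fintype.card J / (Real.pi ^ 2 * R ^ 2))
    (hN : Real.exp (-(Fintype.card (J × κ) : ℝ)) ≤ δ)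
    (hN' : 2 * Real.exp (-(Fintype.card (J × κ) * t' ^ 2 / 2)) ≤ δ) (c : κ → ℝ) :
    ((gaussianPi (J × κ)).prod (phasePi (J × κ))) (ExceptionalEvent H R η t t' S K c) ≤
      ENNReal.ofReal (4 * δ) := by
  set γ := gaussianPi (J × κ)
  set υ := phasePi (J × κ)
  have hfst : ∀ s : Set (J × κ → ℝ), (γ.prod υ) {x | x.1 ∈ s} = γ s := by
    intro s
    have : {x : (J × κ → ℝ) × (J × κ → ℝ) | x.1 ∈ s} = s ×ˢ Set.univ := by ext; simp
    rw [this, Measure.prod_prod, measure_univ, mul_one]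
  have hsnd : ∀ s : Set (J × κ → ℝ), (γ.prod υ) {x | x.2 ∈ s} = υ s := by
    intro s
    have : {x : (J × κ → ℝ) × (J × κ → ℝ) | x.2 ∈ s} = Set.univ ×ˢ s := by ext; simp
    rw [this, Measure.prod_prod, measure_univ, one_mul]
  have b1 : (γ.prod υ) {x | 3 * (Fintype.card (J × κ) : ℝ) ≤ ∑ p, |x.1 p|} ≤ ENNReal.ofReal δ :=
    (hfst {g | 3 * (Fintype.card (J × κ) : ℝ) ≤ ∑ p, |g p|}).trans_le
      (measure_sum_abs_gaussianPi_le.trans (ENNReal.ofReal_le_ofReal hN))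
  have b2 : (γ.prod υ) {x | NetFailure H R η t S K x.1 0} ≤ ENNReal.ofReal δ :=
    (hfst {g | NetFailure H R η t S K g 0}).trans_le
      (measure_netFailure_le hH 0 hR ht hS hδ hδ1 hA hQ)
  set N : Set ((J × κ → ℝ) × (J × κ → ℝ)) :=
    {x | NetFailure H R η t S K x.1 (fun q => 2 * x.2 q)}
  set M : Set ((J × κ → ℝ) × (J × κ → ℝ)) := {x | t' ≤ |cosAverage H 0 (fun q => 2 * x.2 q) 0|}
  have hNm : MeasurableSet N :=
    (isClosed_netFailure H R η t S K (by fun_prop) (by fun_prop)).measurableSet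
  have hMm : MeasurableSet M := (isClosed_le continuous_const (by fun_prop)).measurableSet
  have b3 : (γ.prod υ) N ≤ ENNReal.ofReal δ := by
    rw [Measure.prod_apply_symm hNm]
    refine (lintegral_mono (g := fun _ => ENNReal.ofReal δ) fun b => ?_).trans_eq (by simp)
    exact measure_netFailure_le hH (fun q => 2 * b q) hR ht hS hδ hδ1 hA hQ
  have b4 : (γ.prod υ) M ≤ ENNReal.ofReal δ :=
    (hsnd {b | t' ≤ |cosAverage H 0 (fun q => 2 * b q) 0|}).trans_le
      ((measure_cosAverage_phase_le H ht').trans (ENNReal.ofReal_le_ofReal hN'))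
  have b5 : (γ.prod υ) {x | (x.1, x.2 + transformEntry H x.1 c) ∈ N ∪ M} ≤
      ENNReal.ofReal δ + ENNReal.ofReal δ := by
    -- The doubled phases make both events periodic in `b`, so the shift caused by the centre can be
    -- dropped.
    rw [prod_phasePi_preimage_add γ (a := fun g => transformEntry H g c) ?_ (hNm.union hMm)]
    · exact (measure_union_le _ _).trans (add_le_add b3 b4)
    · intro g b n
      simp only [N, M, Set.mem_union, Set.mem_ofPred_eq, NetFailure, truncationError,
        cosAverage_sub_two_pi_mul]
    · exact (continuous_pi fun q => by fun_prop).measurable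
  refine ((measure_union_le _ _).trans (add_le_add ((measure_union_le _ _).trans
    (add_le_add b1 b2)) b5)).trans_eq ?_
  rw [← ENNReal.ofReal_add hδ.le hδ.le, ← ENNReal.ofReal_add (by positivity) (by positivity)]
  ring_nf

end UniformBound

/-! ### Sylvester matrices are Hadamard -/

section Hadamard

theorem isHadamard_hadamard (l : ℕ) : (hadamard l).IsHadamard := by
  induction l with
  | zero =>
    refine Matrix.IsHadamard.of_mul_conjTranspose (fun i j => ?_) ?_ ?_
    · simp [hadamard]
    · ext i j
      fin_cases i
      fin_cases j
      simp [hadamard, Matrix.mul_apply]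
    · exact isRegular_iff_ne_zero.2 (by simp)
  | succ l ih =>
    refine Matrix.IsHadamard.reindex _ _ (Matrix.IsHadamard.of_mul_conjTranspose ?_ ?_ ?_)
    · rintro (i | i) (j | j)
      · simpa using ih.apply_mem i j
      · simpa using ih.apply_mem i j
      · simpa using ih.apply_mem i j
      · simpa using ih.neg.apply_mem i j
    · rw [Matrix.fromBlocks_conjTranspose, Matrix.fromBlocks_multiply, Matrix.conjTranspose_neg]
      simp only [Matrix.mul_neg, Matrix.neg_mul, neg_neg, add_neg_cancel, ih.mul_conjTranspose,
        ← two_smul ℝ, smul_smul, ← Matrix.fromBlocks_one, Matrix.fromBlocks_smul, smul_zero]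
      simp [two_mul]
    · exact isRegular_iff_ne_zero.2 (by simp)

end Hadamard

/-! ### Joint law of the seed -/

section Law

variable {Ω : Type*} [MeasurableSpace Ω] {μ : Measure Ω} [IsProbabilityMeasure μ] {m l : ℕ}
  {G B : Fin m → Fin (2 ^ l) → Ω → ℝ}

theorem IsSeed.measurePreserving (h : IsSeed μ G B) :
    MeasurePreserving (fun ω => ((fun q : Fin m × Fin (2 ^ l) => G q.1 q.2 ω),
      (fun q : Fin m × Fin (2 ^ l) => B q.1 q.2 ω))) μ
      ((gaussianPi (Fin m × Fin (2 ^ l))).prod (phasePi (Fin m × Fin (2 ^ l)))) := by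
  set f : (Fin m × Fin (2 ^ l)) ⊕ (Fin m × Fin (2 ^ l)) → Ω → ℝ :=
    Sum.elim (fun q => G q.1 q.2) (fun q => B q.1 q.2) with hfdef
  have hf : ∀ i, Measurable (f i) := by
    rintro (q | q)
    · exact h.measurable_diag q.1 q.2
    · exact h.measurable_phase q.1 q.2
  have hprob : ∀ i, IsProbabilityMeasure (μ.map (f i)) := fun i =>
    Measure.isProbabilityMeasure_map (hf i).aemeasurable
  have hmap : MeasurePreserving (fun ω i => f i ω) μ (Measure.pi fun i => μ.map (f i)) :=
    ⟨measurable_pi_lambda _ hf, h.indep.map_fun_eq_pi_map fun i => (hf i).aemeasurable⟩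
  have hcomp := (measurePreserving_sumPiEquivProdPi fun i => μ.map (f i)).comp hmap
  have e1 : (fun q => μ.map (f (Sum.inl q))) = fun _ => gaussianReal 0 1 :=
    funext fun q => h.gaussian_diag q.1 q.2
  have e2 : (fun q => μ.map (f (Sum.inr q))) = fun _ => uniformPhase :=
    funext fun q => h.uniform_phase q.1 q.2
  rw [e1, e2] at hcomp
  exact hcomp

end Law

/-! ### From features to cosine averages -/

section Kernel

variable {m l : ℕ}

theorem rht_eq_transformEntry (g : Fin m → Fin (2 ^ l) → ℝ) (z : EuclideanSpace ℝ (Fin (2 ^ l)))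
    (q : Fin m × Fin (2 ^ l)) :
    rht g z q = transformEntry (hadamard l) (fun q => g q.1 q.2) z.ofLp q := by
  simp [rht, transformEntry, Matrix.mulVec, dotProduct, Matrix.mul_diagonal]

/-- From `2 cos u cos v = cos(u-v) + cos(u+v)`: the phases cancel in the difference and double in
the sum, and the normalization supplies the 2. -/
theorem inner_features (g b : Fin m → Fin (2 ^ l) → ℝ) (x y : EuclideanSpace ℝ (Fin (2 ^ l))) :
    inner ℝ (features g b x) (features g b y) =
      cosAverage (hadamard l) (fun q => g q.1 q.2) 0 (x.ofLp - y.ofLp) +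
      cosAverage (hadamard l) (fun q => g q.1 q.2) (fun q => 2 * b q.1 q.2)
        (x.ofLp + y.ofLp) := by
  have hsqrt : Real.sqrt (2 / ((m : ℝ) * (2 : ℝ) ^ l)) * Real.sqrt (2 / ((m : ℝ) * (2 : ℝ) ^ l)) =
      2 * ((m : ℝ) * (2 : ℝ) ^ l)⁻¹ := by
    rw [Real.mul_self_sqrt (by positivity), div_eq_mul_inv]
  have hcard : (Fintype.card (Fin m × Fin (2 ^ l)) : ℝ) = (m : ℝ) * (2 : ℝ) ^ l := by simp
  rw [cosAverage, cosAverage, hcard, ← mul_add, ← Finset.sum_add_distrib, PiLp.inner_apply,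
    Finset.mul_sum]
  refine Finset.sum_congr rfl fun q _ => ?_
  simp only [features, rht_eq_transformEntry, RCLike.inner_apply, conj_trivial,
    transformEntry_sub, transformEntry_add, Pi.zero_apply, add_zero]
  set a := transformEntry (hadamard l) (fun q => g q.1 q.2) x.ofLp q
  set a' := transformEntry (hadamard l) (fun q => g q.1 q.2) y.ofLp q
  have h1 : Real.cos (a - a') = Real.cos ((a + b q.1 q.2) - (a' + b q.1 q.2)) := by ring_nf
  have h2 : Real.cos (a + a' + 2 * b q.1 q.2) = Real.cos ((a + b q.1 q.2) + (a' + b q.1 q.2)) := by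
    ring_nf
  rw [h1, h2, mul_mul_mul_comm, hsqrt]
  generalize a + b q.1 q.2 = u
  generalize a' + b q.1 q.2 = v
  rw [Real.cos_sub, Real.cos_add]
  ring

/-- Off the exceptional event the argument is deterministic. Writing `x+y = (x-c)+(y-c)+2c`, the
first two terms stay in the ball of radius `R`, and `2c` goes into the phase. -/
theorem abs_inner_features_sub_rbfKernel_le (hm : 0 < m) {W : Set (EuclideanSpace ℝ (Fin (2 ^ l)))}
    {R η t t' : ℝ} {S K : ℕ} (hR : 0 < R) (hη : 0 < η) (hS : R / 2 ^ S < η) (hK : R / η ≤ K)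
    {g b : Fin m → Fin (2 ^ l) → ℝ} {c : EuclideanSpace ℝ (Fin (2 ^ l))}
    (hW : ∀ x ∈ W, ∀ y ∈ W, ‖x - y‖ ≤ R / 2) (hc : c ∈ W)
    (hgb : ((fun q => g q.1 q.2, fun q => b q.1 q.2) :
      (Fin m × Fin (2 ^ l) → ℝ) × (Fin m × Fin (2 ^ l) → ℝ)) ∉
        ExceptionalEvent (hadamard l) R η t t' S K c.ofLp)
    {x y : EuclideanSpace ℝ (Fin (2 ^ l))} (hx : x ∈ W) (hy : y ∈ W) :
    |inner ℝ (features g b x) (features g b y) - rbfKernel x y| ≤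
      2 * (S * t + 3 * 2 ^ l * η + 2 ^ l * (η * R)) + t' := by
  have hH := isHadamard_hadamard l
  have hsq : ∀ z : EuclideanSpace ℝ (Fin (2 ^ l)), ‖z‖ ≤ R → ∑ i, z.ofLp i ^ 2 ≤ R ^ 2 := by
    intro z hz
    rw [← EuclideanSpace.real_norm_sq_eq]
    exact pow_le_pow_left₀ (norm_nonneg _) hz 2
  simp only [ExceptionalEvent, Set.mem_union, Set.mem_ofPred_eq, not_or, not_le, NetFailure,
    not_exists, not_and] at hgb
  obtain ⟨⟨h1, h2⟩, h3, h4⟩ := hgb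
  set g' : Fin m × Fin (2 ^ l) → ℝ := fun q => g q.1 q.2
  set φ : Fin m × Fin (2 ^ l) → ℝ := fun q => 2 * (b q.1 q.2 + transformEntry (hadamard l) g' c.ofLp q)
  have A := abs_cosAverage_sub_exp_mul_le hH (φ := 0) hR hη hS hK h1.le
    (fun s hs p => (h2 s hs p).le) (hsq (x - y) ((hW x hx y hy).trans (by linarith)))
  have hxy : ‖(x - c) + (y - c)‖ ≤ R :=
    (norm_add_le _ _).trans (by linarith [hW x hx c hc, hW y hy c hc])
  have B := abs_cosAverage_sub_exp_mul_le hH (φ := φ) hR hη hS hK h1.le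
    (fun s hs p => (h3 s hs p).le) (hsq _ hxy)
  have e1 : cosAverage (hadamard l) g' 0 0 = 1 := by
    have : (Fintype.card (Fin m × Fin (2 ^ l)) : ℝ) ≠ 0 := by
      simp [hm.ne']
    simp only [cosAverage, transformEntry_zero, Pi.zero_apply, add_zero, Real.cos_zero,
      Finset.sum_const, Finset.card_univ, nsmul_eq_mul, mul_one]
    exact inv_mul_cancel₀ this
  have e2 : cosAverage (hadamard l) g' (fun q => 2 * b q.1 q.2) (x.ofLp + y.ofLp) =
      cosAverage (hadamard l) g' φ ((x - c) + (y - c)).ofLp := by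
    unfold cosAverage
    congr 1
    refine Finset.sum_congr rfl fun q _ => ?_
    simp only [φ, WithLp.ofLp_add, WithLp.ofLp_sub, transformEntry_add, transformEntry_sub]
    ring_nf
  have e3 : rbfKernel x y = Real.exp (-(∑ i, (x - y).ofLp i ^ 2) / 2) := by
    rw [rbfKernel, EuclideanSpace.real_norm_sq_eq, neg_div]
  rw [e1, mul_one, ← e3] at A
  rw [cosAverage_zero_right (g' := 0)] at B
  have hE : |Real.exp (-(∑ i, ((x - c) + (y - c)).ofLp i ^ 2) / 2) *
      cosAverage (hadamard l) 0 φ 0| ≤ t' := by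
    rw [abs_mul, abs_of_pos (Real.exp_pos _)]
    refine (mul_le_of_le_one_left (abs_nonneg _) (Real.exp_le_one_iff.2 ?_)).trans h4.le
    have : 0 ≤ ∑ i, ((x - c) + (y - c)).ofLp i ^ 2 := Finset.sum_nonneg fun i _ => sq_nonneg _
    linarith
  have hd : (Fintype.card (Fin (2 ^ l)) : ℝ) = 2 ^ l := by simp
  rw [hd] at A B
  rw [inner_features, e2]
  rw [WithLp.ofLp_sub] at A
  rw [abs_le] at A B hE ⊢
  constructor <;> linarith [A.1, A.2, B.1, B.2, hE.1, hE.2]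

end Kernel

/-! ### Choice of parameters -/

section Parameters

/-- The number of dyadic scales is logarithmic. -/
theorem exists_scale_count {Λ : ℝ} (hΛ : 2 ≤ Λ) :
    ∃ S : ℕ, 0 < S ∧ 128 * Λ ^ 2 ≤ 2 ^ S ∧ (S : ℝ) ≤ 16 * Real.log Λ := by
  have hl2 : 0.6931471803 < Real.log 2 := Real.log_two_gt_d9
  have hlog : Real.log 2 ≤ Real.log Λ := Real.log_le_log two_pos hΛ
  set x := Real.logb 2 Λ with hx
  have hxl : x * Real.log 2 = Real.log Λ := by
    rw [hx, Real.logb, div_mul_cancel₀ _ (by positivity)]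
  have hx1 : 1 ≤ x := by
    by_contra! h
    nlinarith
  -- `2^7 = 128`, and `7 + 2⌈x⌉ ≤ 9 + 2x ≤ 11x ≤ 16 log Λ`, as `x ≥ 1` and `11 < 16 log 2`.
  refine ⟨7 + 2 * ⌈x⌉₊, by omega, ?_, ?_⟩
  · have h1 : Λ ≤ 2 ^ ⌈x⌉₊ := by
      calc Λ = (2 : ℝ) ^ x := (Real.rpow_logb two_pos (by norm_num) (by linarith)).symm
        _ ≤ (2 : ℝ) ^ ((⌈x⌉₊ : ℕ) : ℝ) :=
          Real.rpow_le_rpow_of_exponent_le (by norm_num) (Nat.le_ceil x)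
        _ = 2 ^ ⌈x⌉₊ := Real.rpow_natCast _ _
    rw [pow_add, mul_comm 2, pow_mul]
    have := pow_le_pow_left₀ (by linarith : (0 : ℝ) ≤ Λ) h1 2
    norm_num
    linarith
  · have h2 := Nat.ceil_lt_add_one (by linarith : 0 ≤ x)
    push_cast
    nlinarith

theorem exp_four_mul_bound {d : ℝ} {S : ℕ} (hS : 0 < S) (hd : d ≤ 2 ^ S) :
    d * (2 * ((2 ^ S : ℕ) : ℝ) + 1) ≤ Real.exp (4 * S) := by
  have h1 : (1 : ℝ) ≤ 2 ^ S := one_le_pow₀ (by norm_num)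
  have h2 : (2 : ℝ) ^ S ≤ Real.exp S := by
    rw [← Real.exp_one_pow]
    exact pow_le_pow_left₀ (by norm_num) (by linarith [Real.add_one_le_exp (1 : ℝ)]) _
  have h3 : (2 : ℝ) ≤ 2 ^ S := by
    calc (2 : ℝ) = 2 ^ 1 := by norm_num
      _ ≤ 2 ^ S := pow_le_pow_right₀ (by norm_num) hS
  calc d * (2 * ((2 ^ S : ℕ) : ℝ) + 1) ≤ 2 ^ S * (2 ^ S * (2 ^ S * 2 ^ S)) := by
        push_cast
        refine mul_le_mul hd ?_ (by positivity) (by positivity)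
        nlinarith [mul_nonneg (sub_nonneg.2 h3) (sub_nonneg.2 h3)]
    _ ≤ Real.exp S * (Real.exp S * (Real.exp S * Real.exp S)) := by gcongr
    _ = Real.exp (4 * S) := by
        rw [← Real.exp_add, ← Real.exp_add, ← Real.exp_add]; ring_nf

theorem log_const_le {δ : ℝ} (hδ : 0 < δ) {k : ℝ} (hk : 0 < k) (n : ℕ) (hn : 0 < n) :
    Real.log (k * n / δ) ≤ k * n + Real.log (1 / δ) := by
  have hn' : (0 : ℝ) < n := by exact_mod_cast hn
  rw [div_eq_mul_one_div, Real.log_mul (by positivity) (by positivity)]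
  linarith [Real.log_le_sub_one_of_pos (by positivity : 0 < k * n)]

end Parameters

end RHTFeatures

/-! ### The main theorem -/

set_option maxHeartbeats 1000000 in
/-- The RBF kernel is approximated uniformly over a bounded set by random Fourier features built
from randomized Hadamard transforms. -/
theorem theorem2 :
    ∃ C : ℝ, 0 < C ∧ ∃ p : ℕ,
      ∀ (l : ℕ) (δ ε : ℝ), 0 < δ → δ < 1 / 2 → 0 < ε → ε < 1 / 2 →
      ∀ W : Set (EuclideanSpace ℝ (Fin (2 ^ l))), Bornology.IsBounded W →
      ∀ m : ℕ,
        C * (1 / ε ^ 2) * (max 1 (Metric.diam W)) ^ 2 * Real.log (1 / δ)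
            * (Real.log ((2 : ℝ) ^ l * max 1 (Metric.diam W) / ε)) ^ p ≤ (m : ℝ) →
      ∀ (Ω : Type*) [MeasurableSpace Ω] (μ : Measure Ω) [IsProbabilityMeasure μ]
        (G B : Fin m → Fin (2 ^ l) → Ω → ℝ), RHTFeatures.IsSeed μ G B →
        1 - δ ≤ μ.real {ω | ∀ x ∈ W, ∀ y ∈ W,
          |inner ℝ (RHTFeatures.features (fun j k => G j k ω) (fun j k => B j k ω) x)
                (RHTFeatures.features (fun j k => G j k ω) (fun j k => B j k ω) y)
            - RHTFeatures.rbfKernel x y| ≤ ε} := by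
  -- With `t = ε/(8S)`, the factor `t⁻²` costs `S²` and the net entropy costs `S`; as `S ≤ 16 log
  -- Λ`, the power is 3, and `62720 · 16³ < 10^9`.
  refine ⟨10 ^ 9, by norm_num, 3, ?_⟩
  intro l δ ε hδ hδ2 hε hε2 W hW m hm Ω _ μ _ G B hseed
  rcases W.eq_empty_or_nonempty with rfl | ⟨c, hc⟩
  · simp [hδ.le]
  set Δ := max 1 (Metric.diam W) with hΔdef
  have hΔ : 1 ≤ Δ := le_max_left _ _
  set d : ℝ := 2 ^ l with hd
  have hd1 : 1 ≤ d := one_le_pow₀ (by norm_num)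
  set Λ := d * Δ / ε with hΛdef
  have hΛε : Λ * ε = d * Δ := by rw [hΛdef]; field_simp
  have hdΔ : 1 ≤ d * Δ := one_le_mul_of_one_le_of_one_le hd1 hΔ
  have hΛ2 : 2 ≤ Λ := by
    rw [hΛdef, le_div_iff₀ hε]; linarith
  have hΛd : d ≤ Λ := by
    rw [hΛdef, le_div_iff₀ hε]
    exact mul_le_mul_of_nonneg_left (by linarith) (by linarith)
  have hΛΔ : Δ ≤ Λ := by
    rw [hΛdef, le_div_iff₀ hε, mul_comm]
    exact mul_le_mul_of_nonneg_right (by linarith) (by linarith)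
  obtain ⟨S, hS0, hS2, hSL⟩ := RHTFeatures.exists_scale_count hΛ2
  have hS1 : (1 : ℝ) ≤ S := by exact_mod_cast hS0
  set ℓ := Real.log (1 / δ) with hℓdef
  have hℓ : 1 / 2 ≤ ℓ := by
    have h1 : Real.log 2 ≤ ℓ := Real.log_le_log two_pos (by
      rw [le_div_iff₀ hδ]; linarith)
    linarith [Real.log_two_gt_d9]
  have hmain : 62720 * S ^ 3 * Δ ^ 2 * ℓ ≤ ε ^ 2 * m := by
    have h1 : (S : ℝ) ^ 3 ≤ (16 * Real.log Λ) ^ 3 := pow_le_pow_left₀ (by positivity) hSL 3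
    have h2 : ε ^ 2 * (10 ^ 9 * (1 / ε ^ 2) * Δ ^ 2 * ℓ * Real.log Λ ^ 3) =
        10 ^ 9 * Δ ^ 2 * ℓ * Real.log Λ ^ 3 := by field_simp
    have h3 := mul_le_mul_of_nonneg_left hm (sq_nonneg ε)
    rw [h2] at h3
    have h4 : 0 ≤ Δ ^ 2 * ℓ := by positivity
    have h5 : 0 ≤ Real.log Λ := Real.log_nonneg (by linarith)
    have h6 := mul_le_mul_of_nonneg_left h1 h4
    have h7 : 0 ≤ Δ ^ 2 * ℓ * Real.log Λ ^ 3 := by positivity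
    linarith
  have hεm : 62720 * ℓ ≤ ε ^ 2 * m := by
    refine le_trans ?_ hmain
    have h1 : (1 : ℝ) ≤ S ^ 3 := one_le_pow₀ hS1
    have h2 : (1 : ℝ) ≤ Δ ^ 2 := one_le_pow₀ hΔ
    have h3 : (1 : ℝ) ≤ S ^ 3 * Δ ^ 2 := one_le_mul_of_one_le_of_one_le h1 h2
    calc 62720 * ℓ = 62720 * 1 * ℓ := by ring
      _ ≤ 62720 * (S ^ 3 * Δ ^ 2) * ℓ := by gcongr
      _ = _ := by ring
  have hm0 : (0 : ℝ) < m := by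
    by_contra! h
    have : ε ^ 2 * m ≤ 0 := mul_nonpos_of_nonneg_of_nonpos (sq_nonneg _) h
    linarith
  have hmε : ε ^ 2 * m ≤ m := by
    exact mul_le_of_le_one_left hm0.le (pow_le_one₀ hε.le (by linarith))
  set R := 2 * Δ with hR
  set η := ε / (40 * d * Δ) with hη
  set t := ε / (8 * S) with ht
  have hR0 : 0 < R := by positivity
  have hη0 : 0 < η := by positivity
  have ht0 : 0 ≤ t := by positivity
  have hRη : R / η ≤ 80 * Λ ^ 2 := by
    have h1 : R / η = 80 * (Δ * Λ) := by rw [hR, hη, hΛdef]; field_simp; norm_num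
    rw [h1, sq]
    gcongr
  have hRηS : R / η < 2 ^ S := by
    refine hRη.trans_lt (lt_of_lt_of_le ?_ hS2)
    nlinarith
  have hRS : R / 2 ^ S < η := by
    rw [div_lt_iff₀ hη0] at hRηS
    rwa [div_lt_iff₀ (by positivity), mul_comm]
  have hdS : d ≤ 2 ^ S := by
    refine hΛd.trans (le_trans ?_ hS2)
    nlinarith
  have hcardJ : ((Fintype.card (Fin m)) : ℝ) = m := by simp
  have hcardκ : ((Fintype.card (Fin (2 ^ l))) : ℝ) = d := by simp [hd]
  have hcard : ((Fintype.card (Fin m × Fin (2 ^ l))) : ℝ) = m * d := by simp [hd]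
  have hmN : (m : ℝ) ≤ m * d := le_mul_of_one_le_right hm0.le hd1
  have hδ4 : 0 < δ / 4 := by positivity
  have hQ : 4 * (4 * (S : ℝ)) + Real.log (2 * S / (δ / 4)) ≤
      2 * t ^ 2 * Fintype.card (Fin m) / (Real.pi ^ 2 * R ^ 2) := by
    have h1 : Real.log (2 * S / (δ / 4)) ≤ 8 * S + ℓ := by
      have := RHTFeatures.log_const_le hδ (by norm_num : (0 : ℝ) < 8) S hS0
      convert this using 2
      field_simp
      norm_num
    have hpi : Real.pi ^ 2 ≤ 10 :=
      (pow_le_pow_left₀ Real.pi_pos.le Real.pi_lt_d2.le 2).trans (by norm_num)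
    rw [hcardJ]
    -- The left side of the goal is at most `24S + ℓ`, hence at most `49Sℓ` because `ℓ ≥ 1/2` and `S
    -- ≥ 1`. Also `62720 = 49 · 10 · 4 · 32`.
    have h2 : 49 * S * ℓ ≤ 2 * t ^ 2 * m / (10 * R ^ 2) := by
      rw [le_div_iff₀ (by positivity), ht, hR]
      have : 2 * (ε / (8 * (S : ℝ))) ^ 2 * m = ε ^ 2 * m / (32 * S ^ 2) := by
        field_simp
        norm_num
      rw [this, le_div_iff₀ (by positivity)]
      calc 49 * S * ℓ * (10 * (2 * Δ) ^ 2) * (32 * S ^ 2) = 62720 * S ^ 3 * Δ ^ 2 * ℓ := by ring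
        _ ≤ _ := hmain
    have h3 : 2 * t ^ 2 * m / (10 * R ^ 2) ≤ 2 * t ^ 2 * m / (Real.pi ^ 2 * R ^ 2) := by
      have := Real.pi_pos
      gcongr
    refine le_trans ?_ (h2.trans h3)
    nlinarith
  have hN : Real.exp (-(Fintype.card (Fin m × Fin (2 ^ l)) : ℝ)) ≤ δ / 4 := by
    have h1 := RHTFeatures.log_const_le hδ (by norm_num : (0 : ℝ) < 4) 1 one_pos
    rw [← Real.exp_log hδ4, Real.exp_le_exp, hcard]
    have h2 : Real.log (δ / 4) = -Real.log (4 * (1 : ℕ) / δ) := by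
      rw [← Real.log_inv]
      congr 1
      push_cast
      field_simp
    rw [h2]
    push_cast at h1 ⊢
    linarith
  have hN' : 2 * Real.exp (-(Fintype.card (Fin m × Fin (2 ^ l)) * (ε / 2) ^ 2 / 2)) ≤ δ / 4 := by
    have h1 := RHTFeatures.log_const_le hδ (by norm_num : (0 : ℝ) < 8) 1 one_pos
    have h2 : δ / 4 = 2 * Real.exp (-Real.log (8 * (1 : ℕ) / δ)) := by
      rw [← Real.log_inv, Real.exp_log (by positivity)]
      push_cast
      field_simp
      norm_num
    rw [h2, hcard]
    gcongr
    push_cast at h1 ⊢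
    have h3 : ε ^ 2 * m ≤ ε ^ 2 * (m * d) := by gcongr
    nlinarith
  have hexc := RHTFeatures.measure_exceptionalEvent_le (J := Fin m)
    (RHTFeatures.isHadamard_hadamard l) (η := η) (K := 2 ^ S)
    hR0 ht0 (by positivity : 0 ≤ ε / 2) hS0 hδ4 (by linarith)
    (by rw [hcardκ]; exact RHTFeatures.exp_four_mul_bound hS0 hdS) hQ hN hN' c.ofLp
  have hEm := RHTFeatures.measurableSet_exceptionalEvent (J := Fin m) (RHTFeatures.hadamard l)
    R η t (ε / 2) S (2 ^ S) c.ofLp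
  set E := RHTFeatures.ExceptionalEvent (J := Fin m) (RHTFeatures.hadamard l)
    R η t (ε / 2) S (2 ^ S) c.ofLp
  have hmp := hseed.measurePreserving
  rw [← hmp.measure_preimage hEm.nullMeasurableSet] at hexc
  have hreal := ENNReal.toReal_le_of_le_ofReal (by positivity) hexc
  rw [mul_div_cancel₀ δ (by norm_num : (4 : ℝ) ≠ 0), ← measureReal_def] at hreal
  have hcompl := probReal_compl_eq_one_sub (μ := μ) (hmp.measurable hEm)
  refine le_trans (by rw [hcompl]; linarith) (measureReal_mono fun ω hω x hx y hy => ?_)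
  have hdist : ∀ x ∈ W, ∀ y ∈ W, ‖x - y‖ ≤ R / 2 := fun x hx y hy => by
    rw [← dist_eq_norm]
    refine (Metric.dist_le_diam_of_mem hW hx hy).trans ?_
    rw [hR, mul_div_cancel_left₀ _ two_ne_zero]
    exact le_max_right _ _
  have hgood : ((fun q => G q.1 q.2 ω, fun q => B q.1 q.2 ω) :
      (Fin m × Fin (2 ^ l) → ℝ) × (Fin m × Fin (2 ^ l) → ℝ)) ∉ E := hω
  refine (RHTFeatures.abs_inner_features_sub_rbfKernel_le (K := 2 ^ S)
    (g := fun j k => G j k ω) (b := fun j k => B j k ω) (by exact_mod_cast hm0) hR0 hη0 hRS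
    (by push_cast; exact hRηS.le) hdist hc hgood hx hy).trans ?_
  have e1 : S * t = ε / 8 := by rw [ht]; field_simp
  have e2 : d * η * Δ = ε / 40 := by rw [hη]; field_simp
  have e3 : d * η ≤ d * η * Δ := le_mul_of_one_le_right (by positivity) hΔ
  rw [← hd, e1, hR]
  -- Error budget: `ε/4` from the scales, at most `ε/4` from rounding and `ε/2` from the phases.
  nlinarith
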